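/- Let $\Bbbk$ be a field and $R_n=\Bbbk[x_1,\dots,x_n]$ for $n\ge 1$. Let $\mathrm{Inc}$ be the monoid of strictly increasing maps $\pi:\mathbb Z_{>0}\to\mathbb Z_{>0}$, acting by $\pi(x_i)=x_{\pi(i)}$, and put $\mathrm{Inc}_{m,n}=\{\pi\in\mathrm{Inc} : \pi(m)\le n\}$. For each $n\ge1$ let $G_n$ be a simple graph on $\{1,\dots,n\}$, and let $I_n=(x_ux_v : \{u,v\}\in E(G_n))\subseteq R_n$ be its edge ideal. Assume that $(I_n)_{n\ge1}$ is an $\mathrm{Inc}$-invariant chain, i.e. $\pi(I_m)\subseteq I_n$ for all $1\le m<n$ and $\pi\in\mathrm{Inc}_{m,n}$, and that $I_n\ne 0$ for all large $n$. Let $r$ be its stability index, i.e. the least $r\ge1$ such that $I_n$ is the ideal of $R_n$ generated by $\mathrm{Inc}_{r,n}(I_r)$ for all $n\ge r$. For a monomial ideal $J\subseteq R_n$ let $p$ be the largest index of a variable dividing a minimal monomial generator of $J$ (with $p=0$ if there is none), let $\delta$ be the largest degree of a minimal monomial generator, and set $q(J)=\sum_{d=0}^{\delta}\dim_\Bbbk\big(R_p/(J\cap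 R_p)\big)_d$. Put $$N=\max\{5r,\ 2r(r-2),\ 4(r+q(I_r))\}.$$ Let $\operatorname{reg} I_n=\sup\{j-i : \operatorname{Tor}_i^{R_n}(\Bbbk,I_n)_j\ne0\}$ be the Castelnuovo–Mumford regularity, and let $\operatorname{indmatch}(G)$ be the largest $g$ such that $G$ has an induced subgraph consisting of $g$ pairwise disjoint edges. Then: (a) $\operatorname{reg} I_n=\operatorname{reg} I_{n+1}$ for all $n\ge N$; moreover $N\le 2(r^2+5r)$. (b) $\lim_{n\to\infty}\operatorname{reg} I_n\in\{2,3\}$. (c) Write $E(G_r)=\{\{i_1,j_1\},\dots,\{i_s,j_s\}\}$ with $1\le i_t<j_t\le r$, $i_1\le i_2\le\dots\le i_s$, and $j_t<j_{t+1}$ whenever $i_t=i_{t+1}$, and let $q=\max\{t : i_t=i_1\}$. The following are equivalent: 1. $\operatorname{reg} I_n=2$ for all sufficiently large $n$; 2. $\operatorname{reg} I_N=2$; 3. either $j_q=\max\{j_1,\dots,j_s\}$, or both $\min\{j_t-i_t : 1\le t\le s\}=1$ and $\operatorname{indmatch}(G_{3r})=1$. -/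

import Mathlib

open MvPolynomial Filter

noncomputable section

namespace IncChain

/-! Throughout, `R_n = 𝕜[x_1, …, x_n]` is `MvPolynomial (Fin n) 𝕜`, with the variable `x_{i+1}`
being `X i`; accordingly the positive integers are shifted to start at `0`. -/

/-! ### The monoid of increasing maps, invariant chains, stability index -/

/-- `Inc_{m,n}`: the strictly increasing maps of the positive integers sending `m` to a number
`≤ n`.  After the shift to `0, 1, 2, …` this says that `{0, …, m-1}` is sent into
`{0, …, n-1}`. -/
def Inc (m n : ℕ) : Set (ℕ → ℕ) := {π | StrictMono π ∧ ∀ i < m, π i < n}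

/-- The action `x_i ↦ x_{π(i)}` of `π ∈ Inc_{m,n}`, as a map `R_m → R_n`. -/
def incAct (𝕜 : Type*) [Field 𝕜] {m n : ℕ} {π : ℕ → ℕ} (hπ : π ∈ Inc m n) :
    MvPolynomial (Fin m) 𝕜 →ₐ[𝕜] MvPolynomial (Fin n) 𝕜 :=
  rename fun i : Fin m => (⟨π i, hπ.2 i i.2⟩ : Fin n)

/-- `Inc`-invariant chains `(I_n)_{n ≥ 1}`.  The value at `n = 0` is never used. -/
def IsInvariantChain {𝕜 : Type*} [Field 𝕜] (I : (n : ℕ) → Ideal (MvPolynomial (Fin n) 𝕜)) :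
    Prop :=
  ∀ m n : ℕ, 1 ≤ m → m < n → ∀ (π : ℕ → ℕ) (hπ : π ∈ Inc m n), ∀ f ∈ I m, incAct 𝕜 hπ f ∈ I n

/-- The ideal of `R_n` generated by `Inc_{m,n}(J)`, for an ideal `J` of `R_m`. -/
def orbitIdeal {𝕜 : Type*} [Field 𝕜] {m : ℕ} (J : Ideal (MvPolynomial (Fin m) 𝕜)) (n : ℕ) :
    Ideal (MvPolynomial (Fin n) 𝕜) :=
  Ideal.span {g | ∃ (π : ℕ → ℕ) (hπ : π ∈ Inc m n), ∃ f ∈ J, g = incAct 𝕜 hπ f}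

/-- The stability index: the least `r ≥ 1` with `I_n = ⟨Inc_{r,n}(I_r)⟩` for all `n ≥ r`. -/
def stabilityIndex {𝕜 : Type*} [Field 𝕜] (I : (n : ℕ) → Ideal (MvPolynomial (Fin n) 𝕜)) : ℕ :=
  sInf {r | 1 ≤ r ∧ ∀ n, r ≤ n → I n = orbitIdeal (I r) n}

/-! ### Edge ideals and induced matchings -/

/-- The edge ideal of a simple graph on `n` vertices. -/
def edgeIdeal (𝕜 : Type*) [Field 𝕜] {n : ℕ} (G : SimpleGraph (Fin n)) :
    Ideal (MvPolynomial (Fin n) 𝕜) :=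
  Ideal.span {f | ∃ u v : Fin n, G.Adj u v ∧ f = X u * X v}

/-- The graph `gK₂`: `g` pairwise disjoint edges. -/
def disjointEdges (g : ℕ) : SimpleGraph (Fin g × Bool) where
  Adj a b := a.1 = b.1 ∧ a.2 ≠ b.2
  symm := ⟨fun _ _ h => ⟨h.1.symm, h.2.symm⟩⟩
  loopless := ⟨fun _ h => h.2 rfl⟩

/-- The induced matching number: the largest `g` such that `gK₂` is (isomorphic to) an induced
subgraph of `G`. -/
def indMatch {n : ℕ} (G : SimpleGraph (Fin n)) : ℕ :=
  sSup {g | Nonempty (disjointEdges g ↪g G)}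

/-! ### Castelnuovo–Mumford regularity

`Tor_i(𝕜, I)_j` is the degree-`j` part of the `i`-th homology of `K ⊗ I`, where `K` is the Koszul
complex on `x_1, …, x_n`, which is the graded free resolution of `𝕜 = R_n / (x_1, …, x_n)`. -/

/-- The underlying space of the Koszul complex: `c` stands for `∑_T c(T) e_T`, where
`e_T = e_{t_1} ∧ ⋯ ∧ e_{t_i}` for `T = {t_1 < ⋯ < t_i}`. -/
abbrev KoszulSpace (𝕜 : Type*) [Field 𝕜] (n : ℕ) : Type _ :=
  Finset (Fin n) → MvPolynomial (Fin n) 𝕜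

/-- The Koszul differential `e_T ↦ ∑_a (-1)^(a-1) x_{t_a} e_{T \ t_a}`, written out on
coefficients. -/
def koszulD (𝕜 : Type*) [Field 𝕜] (n : ℕ) : KoszulSpace 𝕜 n →ₗ[𝕜] KoszulSpace 𝕜 n where
  toFun c U := ∑ v ∈ Uᶜ, (-1) ^ (U.filter (· < v)).card * (X v * c (insert v U))
  map_add' c c' := by
    funext U
    simp only [Pi.add_apply, mul_add, Finset.sum_add_distrib]
  map_smul' a c := by
    funext U
    simp only [Pi.smul_apply, mul_smul_comm, Finset.smul_sum, RingHom.id_apply]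

/-- The degree-`j` part of `K_i ⊗ I`: chains `∑_T c(T) e_T` with `T` running over the `i`-element
sets and `c(T) ∈ I`; here `e_T` has degree `i`, so `c(T)` is homogeneous of degree `j - i`. -/
def koszulChains {𝕜 : Type*} [Field 𝕜] {n : ℕ} (I : Ideal (MvPolynomial (Fin n) 𝕜)) (i j : ℕ) :
    Submodule 𝕜 (KoszulSpace 𝕜 n) where
  carrier := {c | ∀ T, c T ∈ I ∧ (T.card ≠ i → c T = 0) ∧ ∀ m ∈ (c T).support, m.degree + i = j}
  zero_mem' := fun T => ⟨I.zero_mem, fun _ => rfl, by simp⟩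
  add_mem' := by
    classical
    intro c c' hc hc' T
    refine ⟨I.add_mem (hc T).1 (hc' T).1, fun h => ?_, fun m hm => ?_⟩
    · simp [(hc T).2.1 h, (hc' T).2.1 h]
    · rcases Finset.mem_union.1 (support_add hm) with h | h
      · exact (hc T).2.2 m h
      · exact (hc' T).2.2 m h
  smul_mem' := by
    intro a c hc T
    refine ⟨Submodule.smul_of_tower_mem I a (hc T).1, fun h => ?_, fun m hm => ?_⟩
    · simp [(hc T).2.1 h]
    · exact (hc T).2.2 m (support_smul hm)

/-- The cycles of homological degree `i` and internal degree `j`. -/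
def koszulCycles {𝕜 : Type*} [Field 𝕜] {n : ℕ} (I : Ideal (MvPolynomial (Fin n) 𝕜)) (i j : ℕ) :
    Submodule 𝕜 (KoszulSpace 𝕜 n) :=
  koszulChains I i j ⊓ LinearMap.ker (koszulD 𝕜 n)

/-- The boundaries of homological degree `i` and internal degree `j`. -/
def koszulBoundaries {𝕜 : Type*} [Field 𝕜] {n : ℕ} (I : Ideal (MvPolynomial (Fin n) 𝕜))
    (i j : ℕ) : Submodule 𝕜 (KoszulSpace 𝕜 n) :=
  (koszulChains I (i + 1) j).map (koszulD 𝕜 n)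

/-- `Tor_i^{R_n}(𝕜, I)_j`, for a homogeneous ideal `I` of `R_n`. -/
abbrev GradedTor {𝕜 : Type*} [Field 𝕜] {n : ℕ} (I : Ideal (MvPolynomial (Fin n) 𝕜)) (i j : ℕ) :
    Type _ :=
  koszulCycles I i j ⧸ (koszulBoundaries I i j).submoduleOf (koszulCycles I i j)

/-- `reg I = sup {j - i : Tor_i(𝕜, I)_j ≠ 0}` for a homogeneous ideal `I`, with `d = j - i`
(which is never negative, as an ideal lives in nonnegative degrees).  It is `⊥`, that is `-∞`,
for the zero ideal. -/
def reg {𝕜 : Type*} [Field 𝕜] {n : ℕ} (I : Ideal (MvPolynomial (Fin n) 𝕜)) : WithBot ℕ∞ :=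
  sSup {d | ∃ i e : ℕ, Nontrivial (GradedTor I i (i + e)) ∧ d = ((e : ℕ∞) : WithBot ℕ∞)}

/-! ### The `q`-invariant of a monomial ideal -/

/-- The exponents of the minimal monomial generators of a monomial ideal `J`: the monomials of
`J` that are minimal with respect to divisibility. -/
def minGens {𝕜 : Type*} [Field 𝕜] {n : ℕ} (J : Ideal (MvPolynomial (Fin n) 𝕜)) :
    Set (Fin n →₀ ℕ) :=
  {a | Minimal (fun b => monomial b (1 : 𝕜) ∈ J) a}

/-- The maximal index (counted from `1`) of a variable dividing a monomial; `0` for the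
monomial `1`. -/
def monoMaxSupp {n : ℕ} (a : Fin n →₀ ℕ) : ℕ := a.support.sup fun i => (i : ℕ) + 1

/-- `Msupp(J)`: the maximal index occurring in a minimal monomial generator of `J`. -/
def maxSupp {𝕜 : Type*} [Field 𝕜] {n : ℕ} (J : Ideal (MvPolynomial (Fin n) 𝕜)) : ℕ :=
  sSup (monoMaxSupp '' minGens J)

/-- `δ(J)`: the maximal degree of a minimal monomial generator of `J`. -/
def maxGenDegree {𝕜 : Type*} [Field 𝕜] {n : ℕ} (J : Ideal (MvPolynomial (Fin n) 𝕜)) : ℕ :=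
  sSup (Finsupp.degree '' minGens J)

/-- The degree-`d` part of the subring `R_p = 𝕜[x_1, …, x_p]` of `R_n`. -/
def subringPart (𝕜 : Type*) [Field 𝕜] (n p d : ℕ) : Submodule 𝕜 (MvPolynomial (Fin n) 𝕜) :=
  homogeneousSubmodule (Fin n) 𝕜 d ⊓
    Subalgebra.toSubmodule (supported 𝕜 {i : Fin n | (i : ℕ) < p})

/-- `q(J) = ∑_{d = 0}^{δ(J)} dim_𝕜 (R_p / (J ∩ R_p))_d` with `p = Msupp(J)`. -/
def qInvariant {𝕜 : Type*} [Field 𝕜] {n : ℕ} (J : Ideal (MvPolynomial (Fin n) 𝕜)) : ℕ :=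
  ∑ d ∈ Finset.range (maxGenDegree J + 1),
    Module.finrank 𝕜
      (subringPart 𝕜 n (maxSupp J) d ⧸
        (J.restrictScalars 𝕜).submoduleOf (subringPart 𝕜 n (maxSupp J) d))

/-! ### Enumeration of the edges -/

/-- `E(G) = {{i_1,j_1}, …, {i_s,j_s}}` with `i_t < j_t`, `i_1 ≤ ⋯ ≤ i_s`, and `j_t < j_{t+1}`
whenever `i_t = i_{t+1}`: the edges listed without repetition in lexicographic order. -/
structure IsEdgeList {r : ℕ} (G : SimpleGraph (Fin r)) {s : ℕ} (i j : Fin s → Fin r) : Prop where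
  lt : ∀ t, i t < j t
  mono : Monotone i
  lex : ∀ t t' : Fin s, (t' : ℕ) = t + 1 → i t = i t' → j t < j t'
  edgeSet_eq : G.edgeSet = {e | ∃ t, e = s(i t, j t)}

end IncChain

end

/-! Two translations make the problem combinatorial. The Koszul complex of an edge ideal splits by
multidegree. If some exponent is at least 2, the corresponding piece is a cone; in the squarefree
degree `S` it consists of the sets `T ⊆ S` for which `S \ T` contains an edge (`nonfaces`, Alexander
dual to the independence complex of `G[S]`). Hence regularity at most `m` follows from `RegLE`:
exactness at sets of size `i` whenever `i + m < |S|`. A failure of exactness bounds the regularity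
from below.

On the other side, stability makes the graphs explicit: for `n ≥ r`, vertices `a < b` are adjacent
in `G_n` iff some edge `i < j` of `G_r` satisfies `i ≤ a`, `j - i ≤ b - a` and `r - j ≤ n - b`
(`IsShiftGraph`). Let `p` be the least left end and `q` the greatest right end of an edge of `G_r`.
Vertices outside `core` are isolated, and core vertices at distance at least `r` are adjacent unless
they lie near the two opposite ends.

Upper bounds come from `reg G ≤ max(reg(G - v), reg(G - N[v]) + 1)`, iterated along well-chosen
vertex orders (`RegLE.of_elimination`), and from Mayer–Vietoris gluing (`RegLE.union`). They give
regularity at most 3 always (`regLE_three`), and at most 2 if `pq` is an edge of `G_r`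
(`regLE_two_of_rect`) or if `G_r` has an edge `i, i+1` and `G_n` has no two edges forming an induced
`2K₂` (`regLE_two_of_short`). In every other case `not_exactAt_of_path` produces a class showing
regularity at least 3: a non-edge without common non-neighbour that closes up to a cycle of
non-edges. Given an edge `i, i+1`, induced pairs in `G_n` and in `G_{3r}` correspond
(`hasInducedPair_iff`), so the dichotomy does not depend on `n`. All this holds from `n = 4r` on,
and `N ≥ 5r`. -/

namespace IncChain

/-! ### Simplicial homology of set families: link and deletion, cones, Mayer–Vietoris. -/

section Homology

set_option linter.unusedSectionVars false

variable {V : Type*} [LinearOrder V] [Fintype V] (k : Type*) [Field k]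

/-- The simplicial boundary map on all finite subsets of `V`. -/
def bd : (Finset V → k) →ₗ[k] (Finset V → k) where
  toFun c U := ∑ v ∈ Uᶜ, (-1) ^ (U.filter (· < v)).card * c (insert v U)
  map_add' c c' := by
    funext U
    simp only [Pi.add_apply, mul_add, Finset.sum_add_distrib]
  map_smul' a c := by
    funext U
    simp only [Pi.smul_apply, mul_smul_comm, Finset.smul_sum, RingHom.id_apply]

variable {k}

theorem bd_apply (c : Finset V → k) (U : Finset V) :
    bd k c U = ∑ v ∈ Uᶜ, (-1) ^ (U.filter (· < v)).card * c (insert v U) := rfl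

/-- The chain `c` is carried by the sets of cardinality `i` in `𝒯`. -/
def CarriedBy (𝒯 : Set (Finset V)) (i : ℕ) (c : Finset V → k) : Prop :=
  ∀ T, c T ≠ 0 → T ∈ 𝒯 ∧ T.card = i

variable (k) in
/-- The family `𝒯` has no homology in the degree of sets of cardinality `i`. -/
def ExactAt (𝒯 : Set (Finset V)) (i : ℕ) : Prop :=
  ∀ c : Finset V → k, CarriedBy 𝒯 i c → bd k c = 0 →
    ∃ b : Finset V → k, CarriedBy 𝒯 (i + 1) b ∧ bd k b = c

theorem CarriedBy.eq_zero {𝒯 : Set (Finset V)} {i : ℕ} {c : Finset V → k}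
    (h : CarriedBy 𝒯 i c) {T : Finset V} (hT : T ∉ 𝒯) : c T = 0 := by
  by_contra hc
  exact hT (h T hc).1

theorem CarriedBy.mono {𝒯 𝒯' : Set (Finset V)} {i : ℕ} {c : Finset V → k}
    (h : CarriedBy 𝒯 i c) (hs : 𝒯 ⊆ 𝒯') : CarriedBy 𝒯' i c :=
  fun T hT => ⟨hs (h T hT).1, (h T hT).2⟩

theorem CarriedBy.add {𝒯 : Set (Finset V)} {i : ℕ} {c c' : Finset V → k}
    (h : CarriedBy 𝒯 i c) (h' : CarriedBy 𝒯 i c') : CarriedBy 𝒯 i (c + c') := by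
  intro T hT
  by_cases hc : c T = 0
  · exact h' T (by simpa [hc] using hT)
  · exact h T hc

theorem CarriedBy.neg {𝒯 : Set (Finset V)} {i : ℕ} {c : Finset V → k}
    (h : CarriedBy 𝒯 i c) : CarriedBy 𝒯 i (-c) :=
  fun T hT => h T (by simpa using hT)

theorem CarriedBy.sub {𝒯 : Set (Finset V)} {i : ℕ} {c c' : Finset V → k}
    (h : CarriedBy 𝒯 i c) (h' : CarriedBy 𝒯 i c') : CarriedBy 𝒯 i (c - c') := by
  rw [sub_eq_add_neg]
  exact h.add h'.neg

theorem CarriedBy.zero (𝒯 : Set (Finset V)) (i : ℕ) :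
    CarriedBy 𝒯 i (0 : Finset V → k) := fun _ hT => (hT rfl).elim

theorem CarriedBy.bd {𝒯 : Set (Finset V)} (h𝒯 : IsLowerSet 𝒯) {i : ℕ} {c : Finset V → k}
    (h : CarriedBy 𝒯 (i + 1) c) : CarriedBy 𝒯 i (bd k c) := by
  intro U hU
  obtain ⟨v, hv, hne⟩ := Finset.exists_ne_zero_of_sum_ne_zero hU
  have h1 := h _ (right_ne_zero_of_mul hne)
  refine ⟨h𝒯 (Finset.subset_insert v U) h1.1, ?_⟩
  have := Finset.card_insert_of_notMem (Finset.mem_compl.1 hv)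
  omega

theorem card_filter_insert_lt {v w : V} {T : Finset V} (hv : v ∉ T) :
    ((insert v T).filter (· < w)).card = (T.filter (· < w)).card + if v < w then 1 else 0 := by
  rw [Finset.filter_insert]
  split_ifs with h
  · rw [Finset.card_insert_of_notMem (by simp [hv])]
  · rfl

theorem neg_one_pow_swap {v w : V} {T : Finset V} (hv : v ∉ T) (hw : w ∉ T) (hvw : v ≠ w) :
    (-1 : k) ^ (T.filter (· < v)).card * (-1) ^ ((insert v T).filter (· < w)).card =
      -((-1) ^ (T.filter (· < w)).card * (-1) ^ ((insert w T).filter (· < v)).card) := by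
  rw [card_filter_insert_lt hv, card_filter_insert_lt hw]
  rcases lt_or_gt_of_ne hvw with h | h
  · simp only [h, if_true, h.not_gt, if_false]
    ring
  · simp only [h, if_true, h.not_gt, if_false]
    ring

theorem bd_bd (c : Finset V → k) : bd k (bd k c) = 0 := by
  funext U
  simp only [bd_apply, Finset.mul_sum, Pi.zero_apply]
  rw [Finset.sum_sigma']
  refine Finset.sum_involution (fun p _ => ⟨p.2, p.1⟩) ?_ ?_ ?_ ?_
  · rintro ⟨v, w⟩ h
    simp only [Finset.mem_sigma, Finset.mem_compl, Finset.mem_insert, not_or] at h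
    have := neg_one_pow_swap (k := k) h.1 h.2.2 (Ne.symm h.2.1)
    simp only [← mul_assoc]
    rw [this, Finset.insert_comm]
    ring
  · rintro ⟨v, w⟩ h _ he
    simp only [Finset.mem_sigma, Finset.mem_compl, Finset.mem_insert, not_or] at h
    exact h.2.1 (congrArg Sigma.fst he)
  · rintro ⟨v, w⟩ h
    simp only [Finset.mem_sigma, Finset.mem_compl, Finset.mem_insert, not_or] at h ⊢
    exact ⟨h.2.2, Ne.symm h.2.1, h.1⟩
  · rintro ⟨v, w⟩ h
    rfl

/-- The part of a chain on the sets that avoid `v`. -/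
def delPart (v : V) (c : Finset V → k) : Finset V → k := fun T => if v ∈ T then 0 else c T

/-- The part of a chain on the sets that contain `v`, as a chain on the link of `v`. -/
def linkPart (v : V) (c : Finset V → k) : Finset V → k :=
  fun T => if v ∈ T then 0 else (-1) ^ (T.filter (· < v)).card * c (insert v T)

/-- The chain with given deletion and link parts. -/
def joinParts (v : V) (b₀ b₁ : Finset V → k) : Finset V → k :=
  fun T => if v ∈ T then (-1) ^ (T.filter (· < v)).card * b₁ (T.erase v) else b₀ T

/-- Together with `bd_insert_eq` this presents the complex as the mapping cone of the inclusion of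
the link of `v` into its deletion. -/
theorem bd_eq_of_notMem (v : V) (c : Finset V → k) {T : Finset V} (hv : v ∉ T) :
    bd k c T = bd k (delPart v c) T + linkPart v c T := by
  have hT : Tᶜ = insert v (insert v T)ᶜ := by
    ext x
    by_cases hx : x = v <;> simp [hx, hv]
  have hn : v ∉ (insert v T)ᶜ := by simp
  rw [bd_apply, bd_apply, hT, Finset.sum_insert hn, Finset.sum_insert hn]
  have : ∀ w ∈ (insert v T)ᶜ, delPart v c (insert w T) = c (insert w T) := by
    intro w hw
    simp only [Finset.mem_compl, Finset.mem_insert, not_or] at hw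
    simp [delPart, hv, Ne.symm hw.1]
  rw [Finset.sum_congr rfl fun w hw => congrArg _ (this w hw)]
  simp only [delPart, linkPart, Finset.mem_insert_self, if_true, if_neg hv]
  ring

theorem bd_insert_eq (v : V) (c : Finset V → k) {T : Finset V} (hv : v ∉ T) :
    (-1) ^ (T.filter (· < v)).card * bd k c (insert v T) = - bd k (linkPart v c) T := by
  have hT : Tᶜ = insert v (insert v T)ᶜ := by
    ext x
    by_cases hx : x = v <;> simp [hx, hv]
  have hn : v ∉ (insert v T)ᶜ := by simp
  rw [bd_apply, bd_apply, hT, Finset.sum_insert hn, Finset.mul_sum]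
  have h0 : linkPart v c (insert v T) = 0 := by simp [linkPart]
  rw [h0, mul_zero, zero_add, ← Finset.sum_neg_distrib]
  refine Finset.sum_congr rfl fun w hw => ?_
  simp only [Finset.mem_compl, Finset.mem_insert, not_or] at hw
  have hvw : v ∉ insert w T := by simp [hv, Ne.symm hw.1]
  have := neg_one_pow_swap (k := k) hv hw.2 (Ne.symm hw.1)
  rw [← mul_assoc, this, linkPart, if_neg hvw, Finset.insert_comm]
  ring

theorem bd_eq_zero_of_mem {v : V} {c : Finset V → k} (hc : ∀ T, v ∈ T → c T = 0)
    {T : Finset V} (hv : v ∈ T) : bd k c T = 0 :=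
  Finset.sum_eq_zero fun w _ => by rw [hc _ (Finset.mem_insert_of_mem hv), mul_zero]

theorem delPart_joinParts {v : V} {b₀ : Finset V → k} (b₁ : Finset V → k)
    (h₀ : ∀ T, v ∈ T → b₀ T = 0) : delPart v (joinParts v b₀ b₁) = b₀ := by
  funext T
  by_cases hv : v ∈ T
  · simp [delPart, hv, h₀]
  · simp [delPart, joinParts, hv]

theorem linkPart_joinParts {v : V} (b₀ : Finset V → k) {b₁ : Finset V → k}
    (h₁ : ∀ T, v ∈ T → b₁ T = 0) : linkPart v (joinParts v b₀ b₁) = b₁ := by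
  funext T
  by_cases hv : v ∈ T
  · simp [linkPart, hv, h₁]
  · have : ((insert v T).filter (· < v)).card = (T.filter (· < v)).card := by
      rw [card_filter_insert_lt hv]
      simp
    simp only [linkPart, joinParts, hv, if_false, Finset.mem_insert_self, if_true, this,
      Finset.erase_insert hv, ← mul_assoc, ← mul_pow]
    simp

/-- A chain is determined by its deletion and link parts. -/
theorem eq_of_parts (v : V) {c c' : Finset V → k}
    (h0 : ∀ T, v ∉ T → c T = c' T)
    (h1 : ∀ T, v ∉ T → (-1) ^ (T.filter (· < v)).card * c (insert v T) =
      (-1) ^ (T.filter (· < v)).card * c' (insert v T)) : c = c' := by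
  funext T
  by_cases hv : v ∈ T
  · have := h1 (T.erase v) (Finset.notMem_erase v T)
    rw [Finset.insert_erase hv] at this
    exact mul_left_cancel₀ (pow_ne_zero _ (by simp)) this
  · exact h0 T hv

theorem CarriedBy.delPart {𝒯 : Set (Finset V)} {i : ℕ} {c : Finset V → k}
    (h : CarriedBy 𝒯 i c) (v : V) :
    CarriedBy {T | v ∉ T ∧ T ∈ 𝒯} i (delPart v c) := by
  intro T hT
  by_cases hv : v ∈ T
  · simp [IncChain.delPart, hv] at hT
  · simp only [IncChain.delPart, hv, if_false] at hT
    exact ⟨⟨hv, (h T hT).1⟩, (h T hT).2⟩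

theorem CarriedBy.linkPart {𝒯 : Set (Finset V)} {i : ℕ} {c : Finset V → k}
    (h : CarriedBy 𝒯 (i + 1) c) (v : V) :
    CarriedBy {T | v ∉ T ∧ insert v T ∈ 𝒯} i (linkPart v c) := by
  intro T hT
  by_cases hv : v ∈ T
  · simp [IncChain.linkPart, hv] at hT
  · simp only [IncChain.linkPart, hv, if_false] at hT
    have h1 := h _ (right_ne_zero_of_mul hT)
    refine ⟨⟨hv, h1.1⟩, ?_⟩
    have := Finset.card_insert_of_notMem hv
    omega

theorem CarriedBy.joinParts {𝒯 : Set (Finset V)} {v : V} {i : ℕ} {b₀ b₁ : Finset V → k}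
    (h₀ : CarriedBy {T | v ∉ T ∧ T ∈ 𝒯} (i + 1) b₀)
    (h₁ : CarriedBy {T | v ∉ T ∧ insert v T ∈ 𝒯} i b₁) :
    CarriedBy 𝒯 (i + 1) (joinParts v b₀ b₁) := by
  intro T hT
  by_cases hv : v ∈ T
  · simp only [IncChain.joinParts, hv, if_true] at hT
    have h2 := h₁ _ (right_ne_zero_of_mul hT)
    have h3 := h2.1.2
    rw [Finset.insert_erase hv] at h3
    refine ⟨h3, ?_⟩
    rw [← h2.2, Finset.card_erase_add_one hv]
  · simp only [IncChain.joinParts, hv, if_false] at hT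
    exact ⟨(h₀ T hT).1.2, (h₀ T hT).2⟩

theorem bd_linkPart_of_cycle {c : Finset V → k} (hc : bd k c = 0) (v : V) :
    bd k (linkPart v c) = 0 := by
  funext T
  by_cases hv : v ∈ T
  · exact bd_eq_zero_of_mem (fun U hU => by simp [linkPart, hU]) hv
  · have := bd_insert_eq v c hv
    rw [hc] at this
    simpa using this.symm

/-- The long exact sequence of link and deletion, by hand: a filling `b₁` of the link part turns the
deletion part into a cycle, which is filled in turn. At `i = 0` the link part is zero, hence the
form of `h₁`. -/
theorem ExactAt.of_link_deletion {𝒯 : Set (Finset V)} (h𝒯 : IsLowerSet 𝒯) (v : V) {i : ℕ}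
    (h₁ : ∀ i', i = i' + 1 → ExactAt k {T | v ∉ T ∧ insert v T ∈ 𝒯} i')
    (h₀ : ExactAt k {T | v ∉ T ∧ T ∈ 𝒯} i) : ExactAt k 𝒯 i := by
  intro c hc hcyc
  obtain ⟨b₁, hb₁, hbd₁⟩ : ∃ b₁, CarriedBy {T | v ∉ T ∧ insert v T ∈ 𝒯} i b₁ ∧
      bd k b₁ = linkPart v c := by
    rcases i with _ | i
    · refine ⟨0, CarriedBy.zero _ _, ?_⟩
      rw [map_zero]
      funext T
      by_cases hv : v ∈ T
      · simp [linkPart, hv]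
      · have : c (insert v T) = 0 := by
          by_contra h
          have := (hc _ h).2
          simp at this
        simp [linkPart, hv, this]
    · exact h₁ i rfl _ (hc.linkPart v) (bd_linkPart_of_cycle hcyc v)
  have hz₁ : ∀ T, v ∈ T → b₁ T = 0 := fun T hT => hb₁.eq_zero fun h => h.1 hT
  have hsub : {T | v ∉ T ∧ insert v T ∈ 𝒯} ⊆ {T | v ∉ T ∧ T ∈ 𝒯} :=
    fun T hT => ⟨hT.1, h𝒯 (Finset.subset_insert v T) hT.2⟩
  obtain ⟨b₀, hb₀, hbd₀⟩ := h₀ (delPart v c + b₁) ((hc.delPart v).add (hb₁.mono hsub)) (by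
    rw [map_add, hbd₁]
    funext T
    by_cases hv : v ∈ T
    · have := bd_eq_zero_of_mem (c := delPart v c) (fun U hU => by simp [delPart, hU]) hv
      simp [this, linkPart, hv]
    · have := bd_eq_of_notMem v c hv
      rw [hcyc] at this
      simpa using this.symm)
  have hz₀ : ∀ T, v ∈ T → b₀ T = 0 := fun T hT => hb₀.eq_zero fun h => h.1 hT
  have hz₁' : ∀ T, v ∈ T → (-b₁) T = 0 := fun T hT => by simp [hz₁ T hT]
  -- Passing to the link reverses the sign of the boundary (`bd_insert_eq`), hence `-b₁`.
  refine ⟨joinParts v b₀ (-b₁), CarriedBy.joinParts hb₀ hb₁.neg, eq_of_parts v ?_ ?_⟩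
  · intro T hv
    rw [bd_eq_of_notMem v _ hv, delPart_joinParts _ hz₀, linkPart_joinParts _ hz₁', hbd₀]
    simp [delPart, hv]
  · intro T hv
    rw [bd_insert_eq v _ hv, linkPart_joinParts _ hz₁', map_neg, hbd₁]
    simp [linkPart, hv]

/-- Joining with the apex `v` is a contracting homotopy. -/
theorem ExactAt.of_cone {𝒯 : Set (Finset V)} (v : V) (h : ∀ T ∈ 𝒯, insert v T ∈ 𝒯) (i : ℕ) :
    ExactAt k 𝒯 i := by
  intro c hc hcyc
  have hz : ∀ T, v ∈ T → delPart v c T = 0 := fun T hT => by simp [delPart, hT]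
  refine ⟨joinParts v 0 (delPart v c), CarriedBy.joinParts (CarriedBy.zero _ _)
    ((hc.delPart v).mono fun T hT => ⟨hT.1, h T hT.2⟩), eq_of_parts v ?_ ?_⟩
  · intro T hv
    rw [bd_eq_of_notMem v _ hv, delPart_joinParts (b₀ := 0) _ fun _ _ => rfl, linkPart_joinParts _ hz]
    simp [delPart, hv]
  · intro T hv
    rw [bd_insert_eq v _ hv, linkPart_joinParts _ hz]
    have := bd_eq_of_notMem v c hv
    rw [hcyc, Pi.zero_apply, linkPart, if_neg hv] at this
    linear_combination this

/-- Mayer–Vietoris: fillings of `c` in the two families differ by a cycle of the union. A filling of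
that cycle splits into one part in each family, and these parts correct the two fillings to a common
chain. -/
theorem ExactAt.inter {𝒯₁ 𝒯₂ : Set (Finset V)} (l₁ : IsLowerSet 𝒯₁) (l₂ : IsLowerSet 𝒯₂) {i : ℕ}
    (h₁ : ExactAt k 𝒯₁ i) (h₂ : ExactAt k 𝒯₂ i) (h : ExactAt k (𝒯₁ ∪ 𝒯₂) (i + 1)) :
    ExactAt k (𝒯₁ ∩ 𝒯₂) i := by
  classical
  intro c hc hcyc
  obtain ⟨b₁, hb₁, hbd₁⟩ := h₁ c (hc.mono Set.inter_subset_left) hcyc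
  obtain ⟨b₂, hb₂, hbd₂⟩ := h₂ c (hc.mono Set.inter_subset_right) hcyc
  obtain ⟨z, hz, hbdz⟩ := h (b₁ - b₂)
    ((hb₁.mono Set.subset_union_left).sub (hb₂.mono Set.subset_union_right))
    (by rw [map_sub, hbd₁, hbd₂, sub_self])
  set z₁ : Finset V → k := fun T => if T ∈ 𝒯₁ then z T else 0 with hz₁
  set z₂ : Finset V → k := fun T => if T ∈ 𝒯₁ then 0 else z T with hz₂
  have hsum : z = z₁ + z₂ := by
    funext T
    by_cases hT : T ∈ 𝒯₁ <;> simp [hz₁, hz₂, hT]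
  have c₁ : CarriedBy 𝒯₁ (i + 1 + 1) z₁ := by
    intro T hT
    by_cases hm : T ∈ 𝒯₁
    · simp only [hz₁, hm, if_true] at hT
      exact ⟨hm, (hz T hT).2⟩
    · simp [hz₁, hm] at hT
  have c₂ : CarriedBy 𝒯₂ (i + 1 + 1) z₂ := by
    intro T hT
    by_cases hm : T ∈ 𝒯₁
    · simp [hz₂, hm] at hT
    · simp only [hz₂, hm, if_false] at hT
      exact ⟨(hz T hT).1.resolve_left hm, (hz T hT).2⟩
  have e : b₁ - bd k z₁ = b₂ + bd k z₂ := by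
    rw [hsum, map_add] at hbdz
    rw [sub_eq_iff_eq_add, add_assoc, add_comm (bd k z₂), hbdz]
    abel
  have d₁ := hb₁.sub (c₁.bd l₁)
  have d₂ := hb₂.add (c₂.bd l₂)
  rw [← e] at d₂
  refine ⟨b₁ - bd k z₁, fun T hT => ⟨⟨(d₁ T hT).1, (d₂ T hT).1⟩, (d₁ T hT).2⟩, ?_⟩
  rw [map_sub, bd_bd, sub_zero, hbd₁]

end Homology

/-! ### Regularity of graphs through their non-independent complements. -/

section Graph

set_option linter.unusedSectionVars false

variable {V : Type*} [LinearOrder V] [Fintype V] (k : Type*) [Field k] (G : SimpleGraph V)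

/-- The sets `T ⊆ S` such that `S \ T` is not an independent subset of `A`. -/
def nonfaces (S : Finset V) (A : Set V) : Set (Finset V) :=
  {T | T ⊆ S ∧ ((∃ x ∈ S, x ∉ T ∧ x ∉ A) ∨ ∃ x ∈ S, ∃ y ∈ S, x ∉ T ∧ y ∉ T ∧ G.Adj x y)}

theorem isLowerSet_nonfaces (S : Finset V) (A : Set V) : IsLowerSet (nonfaces G S A) := by
  rintro T T' hT' ⟨hT, h⟩
  refine ⟨hT'.trans hT, ?_⟩
  rcases h with ⟨x, hx, hxT, hxA⟩ | ⟨x, hx, y, hy, hxT, hyT, h⟩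
  · exact Or.inl ⟨x, hx, fun h => hxT (hT' h), hxA⟩
  · exact Or.inr ⟨x, hx, y, hy, fun h => hxT (hT' h), fun h => hyT (hT' h), h⟩

/-- The complex of independent subsets of `A`, as a subcomplex of the simplex on `S`, has no
homology that contributes to regularity greater than `m`. -/
def Vanish (m : ℕ) (S : Finset V) (A : Set V) : Prop :=
  ∀ i, i + m < S.card → ExactAt k (nonfaces G S A) i

/-- All induced subgraphs of `G[A]` have regularity at most `m`. -/
def RegLE (m : ℕ) (A : Set V) : Prop :=
  ∀ S : Finset V, (S : Set V) ⊆ A → Vanish k G m S Set.univ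

variable {k G}

theorem RegLE.mono {m m' : ℕ} {A B : Set V} (h : RegLE k G m B) (hm : m ≤ m') (hA : A ⊆ B) :
    RegLE k G m' A :=
  fun S hS i hi => h S (hS.trans hA) i (by omega)

theorem nonfaces_eq_univ {S : Finset V} {A : Set V} (h : (S : Set V) ⊆ A) :
    nonfaces G S A = nonfaces G S Set.univ := by
  ext T
  have : ¬ ∃ x ∈ S, x ∉ T ∧ x ∉ A := by
    rintro ⟨x, hx, -, hxA⟩
    exact hxA (h hx)
  simp [nonfaces, this]

/-- A set missing `w ∉ A` is automatically a nonface, so the deletion of `w` is the full simplex on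
`S`, while the link is the old complex. The bound `m + 1` forces `S` to be nonempty, without which
the simplex would not be a cone. -/
theorem Vanish.insert_ambient {m : ℕ} {S : Finset V} {A : Set V} {w : V} (hw : w ∉ S)
    (hwA : w ∉ A) (h : Vanish k G (m + 1) S A) : Vanish k G (m + 1) (insert w S) A := by
  intro i hi
  rw [Finset.card_insert_of_notMem hw] at hi
  refine ExactAt.of_link_deletion (isLowerSet_nonfaces G _ _) w ?_ ?_
  · rintro i' rfl
    convert h i' (by omega) using 1
    ext T
    simp only [nonfaces, Set.mem_ofPred_eq]
    constructor
    · rintro ⟨hT, hTS, h⟩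
      have hs : T ⊆ S := (Finset.insert_subset_insert_iff hT).1 hTS
      refine ⟨hs, ?_⟩
      rcases h with ⟨x, hx, hxT, hxA⟩ | ⟨x, hx, y, hy, hxT, hyT, h⟩
      · left; refine ⟨x, ?_, ?_, hxA⟩ <;> grind
      · right; refine ⟨x, ?_, y, ?_, ?_, ?_, h⟩ <;> grind
    · rintro ⟨hTS, h⟩
      have hT : w ∉ T := fun h => hw (hTS h)
      refine ⟨hT, Finset.insert_subset_insert _ hTS, ?_⟩
      rcases h with ⟨x, hx, hxT, hxA⟩ | ⟨x, hx, y, hy, hxT, hyT, h⟩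
      · left; refine ⟨x, ?_, ?_, hxA⟩ <;> grind
      · right; refine ⟨x, ?_, y, ?_, ?_, ?_, h⟩ <;> grind
  · obtain ⟨v, hv⟩ : S.Nonempty := by
      rw [← Finset.card_pos]
      omega
    refine ExactAt.of_cone v ?_ i
    rintro T ⟨hT, hTS, -⟩
    have hvw : w ≠ v := by rintro rfl; exact hw hv
    have hwT : w ∉ insert v T := by simp [hT, hvw]
    refine ⟨hwT, ?_, Or.inl ⟨w, Finset.mem_insert_self _ _, hwT, hwA⟩⟩
    exact Finset.insert_subset (Finset.mem_insert_of_mem hv) hTS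

theorem Vanish.of_inter {m : ℕ} {S S' : Finset V} {A : Set V} (hS : S' ⊆ S)
    (hA : ∀ x ∈ S, x ∈ A ↔ x ∈ S') (h : Vanish k G (m + 1) S' Set.univ) :
    Vanish k G (m + 1) S A := by
  have key : ∀ W : Finset V, Disjoint W S' → W ⊆ S → Vanish k G (m + 1) (W ∪ S') A := by
    intro W
    induction W using Finset.induction_on with
    | empty =>
      intro _ _ i hi
      rw [Finset.empty_union] at hi ⊢
      rw [nonfaces_eq_univ fun x hx => (hA x (hS hx)).2 hx]
      exact h i hi
    | insert w W hw ih =>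
      intro hd hs
      rw [Finset.disjoint_insert_left] at hd
      rw [Finset.insert_union]
      refine Vanish.insert_ambient ?_ ?_ (ih hd.2 fun x hx => hs (Finset.mem_insert_of_mem hx))
      · simp [hw, hd.1]
      · exact fun h => hd.1 ((hA w (hs (Finset.mem_insert_self _ _))).1 h)
  have := key (S \ S') Finset.sdiff_disjoint Finset.sdiff_subset
  rwa [Finset.sdiff_union_of_subset hS] at this

theorem RegLE.vanish {m : ℕ} {A : Set V} (h : RegLE k G (m + 1) A) (S : Finset V) :
    Vanish k G (m + 1) S A := by
  classical
  exact Vanish.of_inter (S' := S.filter (· ∈ A)) (Finset.filter_subset _ _)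
    (fun x hx => by simp [hx]) (h _ fun x hx => by simpa using (Finset.mem_filter.1 hx).2)

theorem RegLE.of_indep {m : ℕ} {A : Set V} (hA : ∀ x ∈ A, ∀ y ∈ A, ¬ G.Adj x y) :
    RegLE k G m A := by
  intro S hS i _ c hc _
  have : nonfaces G S Set.univ = ∅ := by
    ext T
    simp only [nonfaces, Set.mem_ofPred_eq, Set.mem_empty_iff_false, iff_false]
    rintro ⟨-, ⟨x, -, -, hx⟩ | ⟨x, hx, y, hy, -, -, h⟩⟩
    · exact hx trivial
    · exact hA x (hS hx) y (hS hy) h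
  refine ⟨0, CarriedBy.zero _ _, ?_⟩
  rw [map_zero]
  funext T
  exact (hc.eq_zero (by simp [this])).symm

/-- In the link, `v` has been removed from the graph. In the deletion, `v` stays in the complement
of `T`, so independence of that complement requires its other vertices to be non-neighbours of `v`.
-/
theorem Vanish.of_vertex {m : ℕ} {S : Finset V} {v : V} (hv : v ∉ S)
    (h : Vanish k G (m + 1) S Set.univ) (h' : Vanish k G m S {x | ¬ G.Adj x v}) :
    Vanish k G (m + 1) (insert v S) Set.univ := by
  intro i hi
  rw [Finset.card_insert_of_notMem hv] at hi
  refine ExactAt.of_link_deletion (isLowerSet_nonfaces G _ _) v ?_ ?_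
  · rintro i' rfl
    convert h i' (by omega) using 1
    ext T
    simp only [nonfaces, Set.mem_ofPred_eq]
    constructor
    · rintro ⟨hT, hTS, h⟩
      have hs : T ⊆ S := (Finset.insert_subset_insert_iff hT).1 hTS
      refine ⟨hs, ?_⟩
      rcases h with ⟨x, hx, hxT, hxA⟩ | ⟨x, hx, y, hy, hxT, hyT, h⟩
      · exact (hxA trivial).elim
      · right; refine ⟨x, ?_, y, ?_, ?_, ?_, h⟩ <;> grind
    · rintro ⟨hTS, h⟩
      have hT : v ∉ T := fun h => hv (hTS h)
      refine ⟨hT, Finset.insert_subset_insert _ hTS, ?_⟩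
      rcases h with ⟨x, hx, hxT, hxA⟩ | ⟨x, hx, y, hy, hxT, hyT, h⟩
      · exact (hxA trivial).elim
      · right; refine ⟨x, ?_, y, ?_, ?_, ?_, h⟩ <;> grind
  · convert h' i (by omega) using 1
    ext T
    simp only [nonfaces, Set.mem_ofPred_eq, not_not]
    constructor
    · rintro ⟨hT, hTS, h⟩
      have hs : T ⊆ S := (Finset.subset_insert_iff_of_notMem hT).1 hTS
      refine ⟨hs, ?_⟩
      rcases h with ⟨x, hx, hxT, hxA⟩ | ⟨x, hx, y, hy, hxT, hyT, h⟩
      · exact (hxA trivial).elim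
      · rcases Finset.mem_insert.1 hx with rfl | hx'
        · rcases Finset.mem_insert.1 hy with rfl | hy'
          · exact (G.loopless.irrefl _ h).elim
          · exact Or.inl ⟨y, hy', hyT, h.symm⟩
        · rcases Finset.mem_insert.1 hy with rfl | hy'
          · exact Or.inl ⟨x, hx', hxT, h⟩
          · exact Or.inr ⟨x, hx', y, hy', hxT, hyT, h⟩
    · rintro ⟨hTS, h⟩
      have hT : v ∉ T := fun h => hv (hTS h)
      refine ⟨hT, hTS.trans (Finset.subset_insert _ _), Or.inr ?_⟩
      rcases h with ⟨x, hx, hxT, hxA⟩ | ⟨x, hx, y, hy, hxT, hyT, h⟩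
      · exact ⟨x, Finset.mem_insert_of_mem hx, v, Finset.mem_insert_self _ _, hxT, hT, hxA⟩
      · exact ⟨x, Finset.mem_insert_of_mem hx, y, Finset.mem_insert_of_mem hy, hxT, hyT, h⟩

/-- Removing a vertex `v` whose non-neighbours span a graph of smaller regularity. -/
theorem RegLE.of_vertex {m : ℕ} {A : Set V} (v : V) (h : RegLE k G (m + 2) (A \ {v}))
    (h' : RegLE k G (m + 1) {x ∈ A | x ≠ v ∧ ¬ G.Adj x v}) : RegLE k G (m + 2) A := by
  intro S hS
  by_cases hv : v ∈ S
  · rw [← Finset.insert_erase hv]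
    have hs : ∀ x ∈ S.erase v, x ∈ A ∧ x ≠ v := fun x hx =>
      ⟨hS (Finset.mem_of_mem_erase hx), Finset.ne_of_mem_erase hx⟩
    refine Vanish.of_vertex (Finset.notMem_erase v S) (h _ fun x hx => hs x hx) ?_
    classical
    refine Vanish.of_inter (S' := (S.erase v).filter fun x => ¬ G.Adj x v)
      (Finset.filter_subset _ _) (fun x hx => by simp only [Finset.mem_filter, hx, true_and]; rfl)
      (h' _ fun x hx => ?_)
    have hx' := Finset.mem_filter.1 (Finset.mem_coe.1 hx)
    exact ⟨(hs x hx'.1).1, (hs x hx'.1).2, hx'.2⟩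
  · exact h S fun x hx => ⟨hS hx, by rintro rfl; exact hv hx⟩

/-- Removing the vertices of `M` one by one, the ones of largest rank first. -/
theorem RegLE.of_elimination {m : ℕ} {A : Set V} (rank : V → ℕ) (hr : Function.Injective rank)
    (M : Finset V) (h : RegLE k G (m + 2) {x ∈ A | x ∉ M})
    (h' : ∀ v ∈ M, v ∈ A →
      RegLE k G (m + 1) {x ∈ A | ¬ G.Adj x v ∧ (x ∉ M ∨ rank x < rank v)}) :
    RegLE k G (m + 2) A := by
  induction hn : M.card generalizing A M with
  | zero =>
    rw [Finset.card_eq_zero] at hn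
    subst hn
    simpa using h
  | succ n ih =>
    have hne : M.Nonempty := by
      rw [← Finset.card_pos]
      omega
    obtain ⟨v, hvM, hmax⟩ := M.exists_max_image rank hne
    have hlt : ∀ x ∈ M, x ≠ v → rank x < rank v := fun x hx hxv =>
      lt_of_le_of_ne (hmax x hx) fun he => hxv (hr he)
    have hA : RegLE k G (m + 2) (A \ {v}) := by
      refine ih (M.erase v) (h.mono le_rfl ?_) ?_ (by rw [Finset.card_erase_of_mem hvM, hn]; rfl)
      · rintro x ⟨⟨hx, hxv⟩, hxM⟩
        exact ⟨hx, fun hM => hxM (Finset.mem_erase.2 ⟨hxv, hM⟩)⟩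
      · intro w hw hwA
        refine (h' w (Finset.mem_of_mem_erase hw) hwA.1).mono le_rfl ?_
        rintro x ⟨⟨hx, hxv⟩, hxw, hxM⟩
        refine ⟨hx, hxw, hxM.imp (fun hxM hM => hxM (Finset.mem_erase.2 ⟨hxv, hM⟩)) id⟩
    by_cases hvA : v ∈ A
    · refine RegLE.of_vertex v hA ((h' v hvM hvA).mono le_rfl ?_)
      rintro x ⟨hx, hxv, hadj⟩
      refine ⟨hx, hadj, ?_⟩
      by_cases hxM : x ∈ M
      · exact Or.inr (hlt x hxM hxv)
      · exact Or.inl hxM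
    · rwa [Set.sdiff_singleton_eq_self hvA] at hA

/-- Isolated vertices may be removed. -/
theorem RegLE.of_isolated {m : ℕ} {A B : Set V} (h : RegLE k G m B)
    (hiso : ∀ x ∈ A, x ∉ B → ∀ y ∈ A, ¬ G.Adj x y) : RegLE k G m A := by
  intro S hS
  by_cases hSB : (S : Set V) ⊆ B
  · exact h S hSB
  obtain ⟨v, hv, hvB⟩ := Set.not_subset.1 hSB
  intro i _
  -- The edge witnessing that `T` is a nonface avoids the isolated vertex `v`, so it survives adding
  -- `v` to `T`.
  refine ExactAt.of_cone v ?_ i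
  rintro T ⟨hT, ⟨x, -, -, hx⟩ | ⟨x, hx, y, hy, hxT, hyT, hadj⟩⟩
  · exact (hx trivial).elim
  refine ⟨Finset.insert_subset hv hT, Or.inr ⟨x, hx, y, hy, ?_, ?_, hadj⟩⟩
  · rw [Finset.mem_insert, not_or]
    refine ⟨?_, hxT⟩
    rintro rfl
    exact hiso x (hS hx) hvB y (hS hy) hadj
  · rw [Finset.mem_insert, not_or]
    refine ⟨?_, hyT⟩
    rintro rfl
    exact hiso y (hS hy) hvB x (hS hx) hadj.symm

/-- Gluing along an independent set, with all edges between the two remaining parts. -/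
theorem RegLE.union {m : ℕ} {A B : Set V} (hA : RegLE k G (m + 2) A) (hB : RegLE k G (m + 2) B)
    (hAB : ∀ x ∈ A ∩ B, ∀ y ∈ A ∩ B, ¬ G.Adj x y)
    (hadj : ∀ x ∈ A, x ∉ B → ∀ y ∈ B, y ∉ A → G.Adj x y) : RegLE k G (m + 2) (A ∪ B) := by
  intro S hS i hi
  have h₁ := hA.vanish S i hi
  have h₂ := hB.vanish S i hi
  -- The union is needed one degree higher; since `A ∩ B` is independent, the bound can be lowered
  -- by one to pay for it.
  have h₃ := (RegLE.of_indep (k := k) (m := m + 1) hAB).vanish S (i + 1) (by omega)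
  have e₁ : nonfaces G S A ∪ nonfaces G S B = nonfaces G S (A ∩ B) := by
    ext T
    simp only [nonfaces, Set.mem_union, Set.mem_ofPred_eq, Set.mem_inter_iff, not_and_or]
    constructor
    · rintro (⟨hT, ⟨x, hx, hxT, hxA⟩ | h⟩ | ⟨hT, ⟨x, hx, hxT, hxA⟩ | h⟩)
      · exact ⟨hT, Or.inl ⟨x, hx, hxT, Or.inl hxA⟩⟩
      · exact ⟨hT, Or.inr h⟩
      · exact ⟨hT, Or.inl ⟨x, hx, hxT, Or.inr hxA⟩⟩
      · exact ⟨hT, Or.inr h⟩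
    · rintro ⟨hT, ⟨x, hx, hxT, hxA | hxA⟩ | h⟩
      · exact Or.inl ⟨hT, Or.inl ⟨x, hx, hxT, hxA⟩⟩
      · exact Or.inr ⟨hT, Or.inl ⟨x, hx, hxT, hxA⟩⟩
      · exact Or.inl ⟨hT, Or.inr h⟩
  -- If `S \ T` leaves both `A` and `B`, the two escaping vertices are adjacent by `hadj`.
  have e₂ : nonfaces G S A ∩ nonfaces G S B = nonfaces G S Set.univ := by
    ext T
    simp only [nonfaces, Set.mem_inter_iff, Set.mem_ofPred_eq]
    constructor
    · rintro ⟨⟨hT, ⟨x, hx, hxT, hxA⟩ | h⟩, -, h'⟩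
      · rcases h' with ⟨y, hy, hyT, hyB⟩ | h'
        · have hxB := (hS hx).resolve_left hxA
          have hyA := (hS hy).resolve_right hyB
          exact ⟨hT, Or.inr ⟨y, hy, x, hx, hyT, hxT, hadj y hyA hyB x hxB hxA⟩⟩
        · exact ⟨hT, Or.inr h'⟩
      · exact ⟨hT, Or.inr h⟩
    · rintro ⟨hT, ⟨x, -, -, hx⟩ | h⟩
      · exact (hx trivial).elim
      · exact ⟨⟨hT, Or.inr h⟩, hT, Or.inr h⟩
  rw [← e₁] at h₃
  rw [← e₂]
  exact ExactAt.inter (isLowerSet_nonfaces G _ _) (isLowerSet_nonfaces G _ _) h₁ h₂ h₃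

variable (k) in
theorem not_exactAt_of_adj {u w : V} (h : G.Adj u w) :
    ¬ ExactAt k (nonfaces G {u, w} Set.univ) 0 := by
  intro hex
  obtain ⟨b, hb, hbd⟩ := hex (fun T => if T = ∅ then 1 else 0) (by
    intro T hT
    have : T = ∅ := by
      by_contra hne
      simp [hne] at hT
    subst this
    exact ⟨⟨Finset.empty_subset _, Or.inr ⟨u, by simp, w, by simp, by simp, by simp, h⟩⟩, rfl⟩) (by
    funext U
    exact Finset.sum_eq_zero fun v _ => by simp)
  have hz : b = 0 := by
    funext T
    by_contra hT
    obtain ⟨⟨hTS, ⟨x, -, -, hx⟩ | ⟨x, hx, y, hy, hxT, hyT, hadj⟩⟩, hcard⟩ := hb T hT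
    · exact hx trivial
    · obtain ⟨z, rfl⟩ := Finset.card_eq_one.1 hcard
      have hne := hadj.ne
      simp only [Finset.singleton_subset_iff, Finset.mem_insert, Finset.mem_singleton] at *
      grind
  rw [hz, map_zero] at hbd
  have := congrFun hbd ∅
  simp at this

variable (k) in
/-- A non-edge `uw` which has no common non-neighbour in `S`, and whose end points are joined by
another path of non-edges in `S`, yields a nonzero homology class. -/
theorem not_exactAt_of_path {S : Finset V} {u w : V} (hu : u ∈ S) (hw : w ∈ S) (huw : u ≠ w)
    (hnadj : ¬ G.Adj u w) (hcommon : ∀ x ∈ S, x ≠ u → x ≠ w → G.Adj u x ∨ G.Adj w x)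
    (hpath : Relation.ReflTransGen (fun x y => x ∈ S ∧ y ∈ S ∧ x ≠ y ∧ ¬ G.Adj x y ∧
      ¬ (x = u ∧ y = w) ∧ ¬ (x = w ∧ y = u)) u w) {i : ℕ} (hi : i + 3 = S.card) :
    ¬ ExactAt k (nonfaces G S Set.univ) i := by
  classical
  intro hex
  set D : Finset V := S \ {u, w} with hD
  have hpair : ∀ x y, x ∈ S → y ∈ S → x ≠ y → (S \ {x, y}).card = i + 1 := by
    intro x y hx hy hxy
    rw [Finset.card_sdiff_of_subset (by grind), Finset.card_pair hxy]
    omega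
  -- The class is the boundary of the face `D`. As `uw` is a non-edge, `D` is not a nonface; the
  -- facets of `D` are, because each complement `{u, w, v}` contains an edge by `hcommon`.
  set h : Finset V → k := fun T => if T = D then 1 else 0 with hh
  obtain ⟨b, hb, hbd⟩ := hex (bd k h) (by
    intro U hU
    obtain ⟨v, hv, hne⟩ := Finset.exists_ne_zero_of_sum_ne_zero hU
    have hvU := Finset.mem_compl.1 hv
    have hE : insert v U = D := by
      by_contra hE
      simp [hh, hE] at hne
    have hvD : v ∈ D := hE ▸ Finset.mem_insert_self v U
    rw [hD, Finset.mem_sdiff, Finset.mem_insert, Finset.mem_singleton, not_or] at hvD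
    have hUS : U ⊆ S := (Finset.subset_insert v U).trans (hE ▸ Finset.sdiff_subset)
    have huU : u ∉ U := fun h => by
      have : u ∈ D := hE ▸ Finset.mem_insert_of_mem h
      simp [hD] at this
    have hwU : w ∉ U := fun h => by
      have : w ∈ D := hE ▸ Finset.mem_insert_of_mem h
      simp [hD] at this
    refine ⟨⟨hUS, Or.inr ?_⟩, ?_⟩
    · rcases hcommon v hvD.1 hvD.2.1 hvD.2.2 with h | h
      · exact ⟨u, hu, v, hvD.1, huU, hvU, h⟩
      · exact ⟨w, hw, v, hvD.1, hwU, hvU, h⟩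
    · have h1 := Finset.card_insert_of_notMem hvU
      have h2 := hpair u w hu hw huw
      rw [hE, hD] at h1
      omega) (bd_bd h)
  -- A cycle of the full simplex: read on complements of pairs it is a 1-cocycle. It vanishes on all
  -- non-edges except `uw`, where it equals 1, and the path of non-edges contradicts this.
  set c : Finset V → k := h - b with hc
  have hcyc : bd k c = 0 := by rw [hc, map_sub, hbd, sub_self]
  have hcS : ∀ T, c T ≠ 0 → T ⊆ S := by
    intro T hT
    by_contra hTS
    have h1 : h T = 0 := by
      simp only [hh, ite_eq_right_iff]
      rintro rfl
      exact (hTS Finset.sdiff_subset).elim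
    have h2 : b T = 0 := by
      by_contra h2
      exact hTS (hb T h2).1.1
    exact hT (by simp [hc, h1, h2])
  -- being equal or having `c (S \ {x, y}) = 0` is a transitive relation
  have htrans : ∀ x y z, x ∈ S → y ∈ S → z ∈ S → x ≠ y → y ≠ z → x ≠ z →
      c (S \ {x, y}) = 0 → c (S \ {y, z}) = 0 → c (S \ {x, z}) = 0 := by
    intro x y z hx hy hz hxy hyz hxz h1 h2
    have h0 := congrFun hcyc (S \ {x, y, z})
    rw [bd_apply, Pi.zero_apply, Finset.sum_eq_single y] at h0
    · have hE : insert y (S \ {x, y, z}) = S \ {x, z} := by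
        ext t
        simp only [Finset.mem_insert, Finset.mem_sdiff, Finset.mem_singleton]
        grind
      rw [hE] at h0
      exact (mul_eq_zero.1 h0).resolve_left (pow_ne_zero _ (by simp))
    · intro t ht hty
      by_cases htS : t ∈ S
      · have : t = x ∨ t = z := by
          simp only [Finset.mem_compl, Finset.mem_sdiff, Finset.mem_insert,
            Finset.mem_singleton] at ht
          grind
        rcases this with rfl | rfl
        · have hE : insert t (S \ {t, y, z}) = S \ {y, z} := by
            ext s
            simp only [Finset.mem_insert, Finset.mem_sdiff, Finset.mem_singleton]
            grind
          rw [hE, h2, mul_zero]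
        · have hE : insert t (S \ {x, y, t}) = S \ {x, y} := by
            ext s
            simp only [Finset.mem_insert, Finset.mem_sdiff, Finset.mem_singleton]
            grind
          rw [hE, h1, mul_zero]
      · have : c (insert t (S \ {x, y, z})) = 0 := by
          by_contra hne
          exact htS (hcS _ hne (Finset.mem_insert_self _ _))
        rw [this, mul_zero]
    · intro hy'
      simp at hy'
  have hmem : ∀ x y t, t ∈ S → t ∉ S \ {x, y} → t = x ∨ t = y := by
    intro x y t ht htT
    by_contra hne
    exact htT (Finset.mem_sdiff.2 ⟨ht, by simpa [not_or] using hne⟩)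
  have hb0 : ∀ x y, ¬ G.Adj x y → b (S \ {x, y}) = 0 := by
    intro x y hxy
    refine hb.eq_zero ?_
    rintro ⟨-, ⟨t, -, -, ht⟩ | ⟨s, hs, t, ht, hsT, htT, hadj⟩⟩
    · exact ht trivial
    · have hne := hadj.ne
      have hs' := hmem x y s hs hsT
      have ht' := hmem x y t ht htT
      rcases hs' with rfl | rfl <;> rcases ht' with rfl | rfl
      · exact hne rfl
      · exact hxy hadj
      · exact hxy hadj.symm
      · exact hne rfl
  have hstep : ∀ x y, x ∈ S → y ∈ S → x ≠ y → ¬ G.Adj x y → ¬ (x = u ∧ y = w) →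
      ¬ (x = w ∧ y = u) → c (S \ {x, y}) = 0 := by
    intro x y hx hy hxy hn h1 h2
    have : S \ {x, y} ≠ D := by
      intro hE
      have hx' := hmem u w x hx (by rw [← hD, ← hE]; simp)
      have hy' := hmem u w y hy (by rw [← hD, ← hE]; simp)
      rcases hx' with rfl | rfl <;> rcases hy' with rfl | rfl
      · exact hxy rfl
      · exact h1 ⟨rfl, rfl⟩
      · exact h2 ⟨rfl, rfl⟩
      · exact hxy rfl
    rw [hc, Pi.sub_apply, hb0 x y hn, sub_zero]
    exact if_neg this
  have hreach : ∀ y, Relation.ReflTransGen (fun x y => x ∈ S ∧ y ∈ S ∧ x ≠ y ∧ ¬ G.Adj x y ∧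
      ¬ (x = u ∧ y = w) ∧ ¬ (x = w ∧ y = u)) u y → y ∈ S ∧ (u = y ∨ c (S \ {u, y}) = 0) := by
    intro y hy
    induction hy with
    | refl => exact ⟨hu, Or.inl rfl⟩
    | @tail x y _ hxy ih =>
      obtain ⟨hx, hy, hne, hn, h1, h2⟩ := hxy
      refine ⟨hy, ?_⟩
      have hs := hstep x y hx hy hne hn h1 h2
      by_cases huy : u = y
      · exact Or.inl huy
      · right
        rcases ih.2 with rfl | hux
        · exact hs
        · by_cases hux' : u = x
          · subst hux'; exact hs
          · exact htrans u x y hu hx hy hux' hne huy hux hs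
  have := ((hreach w hpath).2.resolve_left huw)
  rw [← hD, hc, Pi.sub_apply, hb0 u w hnadj] at this
  simp [hh] at this

end Graph

/-! ### Graded Tor of an edge ideal, computed multidegree by multidegree. -/

section Algebra

variable {𝕜 : Type*} [Field 𝕜] {n : ℕ}

theorem single_add_single_le {σ : Type*} {u v : σ} (h : u ≠ v) {m : σ →₀ ℕ} :
    Finsupp.single u 1 + Finsupp.single v 1 ≤ m ↔ m u ≠ 0 ∧ m v ≠ 0 := by
  classical
  constructor
  · intro hle
    have hu := hle u
    have hv := hle v
    simp only [Finsupp.add_apply, Finsupp.single_apply, if_true, h, h.symm, if_false] at hu hv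
    omega
  · rintro ⟨hu, hv⟩ x
    simp only [Finsupp.add_apply, Finsupp.single_apply]
    by_cases hxu : u = x
    · subst hxu
      simp only [if_true, h.symm, if_false]
      omega
    · by_cases hxv : v = x
      · subst hxv
        simp only [if_true, h, if_false]
        omega
      · simp [hxu, hxv]

theorem edgeIdeal_eq_span (G : SimpleGraph (Fin n)) : edgeIdeal 𝕜 G =
    Ideal.span ((fun s => monomial s (1 : 𝕜)) ''
      {s | ∃ u v, G.Adj u v ∧ s = Finsupp.single u 1 + Finsupp.single v 1}) := by
  unfold edgeIdeal
  congr 1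
  ext f
  simp only [Set.mem_ofPred_eq, Set.mem_image]
  constructor
  · rintro ⟨u, v, h, rfl⟩
    exact ⟨_, ⟨u, v, h, rfl⟩, by simp [X, monomial_mul]⟩
  · rintro ⟨s, ⟨u, v, h, rfl⟩, rfl⟩
    exact ⟨u, v, h, by simp [X, monomial_mul]⟩

theorem mem_edgeIdeal {G : SimpleGraph (Fin n)} {f : MvPolynomial (Fin n) 𝕜} :
    f ∈ edgeIdeal 𝕜 G ↔ ∀ m ∈ f.support, ∃ u v, G.Adj u v ∧ m u ≠ 0 ∧ m v ≠ 0 := by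
  rw [edgeIdeal_eq_span, mem_ideal_span_monomial_image]
  refine forall₂_congr fun m _ => ?_
  constructor
  · rintro ⟨s, ⟨u, v, h, rfl⟩, hle⟩
    exact ⟨u, v, h, (single_add_single_le h.ne).1 hle⟩
  · rintro ⟨u, v, h, huv⟩
    exact ⟨_, ⟨u, v, h, rfl⟩, (single_add_single_le h.ne).2 huv⟩

theorem monomial_mem_edgeIdeal {G : SimpleGraph (Fin n)} {m : Fin n →₀ ℕ} {a : 𝕜} (ha : a ≠ 0) :
    monomial m a ∈ edgeIdeal 𝕜 G ↔ ∃ u v, G.Adj u v ∧ m u ≠ 0 ∧ m v ≠ 0 := by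
  classical
  rw [mem_edgeIdeal, support_monomial, if_neg ha]
  simp

/-- The exponent vector of the squarefree monomial with support `T`. -/
noncomputable def indicatorExp (T : Finset (Fin n)) : Fin n →₀ ℕ :=
  Finsupp.equivFunOnFinite.symm fun v => if v ∈ T then 1 else 0

theorem indicatorExp_apply (T : Finset (Fin n)) (v : Fin n) :
    indicatorExp T v = if v ∈ T then 1 else 0 := rfl

theorem indicatorExp_le {T : Finset (Fin n)} {α : Fin n →₀ ℕ} :
    indicatorExp T ≤ α ↔ T ⊆ α.support := by
  constructor
  · intro h v hv
    have := h v
    rw [indicatorExp_apply, if_pos hv] at this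
    rw [Finsupp.mem_support_iff]
    omega
  · intro h v
    rw [indicatorExp_apply]
    split_ifs with hv
    · have := Finsupp.mem_support_iff.1 (h hv)
      omega
    · exact Nat.zero_le _

theorem degree_indicatorExp (T : Finset (Fin n)) : (indicatorExp T).degree = T.card := by
  rw [Finsupp.degree_eq_sum]
  simp [indicatorExp_apply]

theorem support_indicatorExp (T : Finset (Fin n)) : (indicatorExp T).support = T := by
  ext v
  simp [indicatorExp_apply]

theorem indicatorExp_insert {v : Fin n} {U : Finset (Fin n)} (hv : v ∉ U) :
    indicatorExp (insert v U) = indicatorExp U + Finsupp.single v 1 := by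
  ext x
  simp only [indicatorExp_apply, Finsupp.add_apply, Finsupp.single_apply, Finset.mem_insert]
  by_cases h : x = v
  · subst h
    simp [hv]
  · simp [h, Ne.symm h]

/-- The component of a Koszul chain in multidegree `α`. -/
noncomputable def slice (α : Fin n →₀ ℕ) (c : KoszulSpace 𝕜 n) : Finset (Fin n) → 𝕜 :=
  fun T => if T ⊆ α.support then coeff (α - indicatorExp T) (c T) else 0

/-- The Koszul differential respects the fine grading; within one multidegree the variables are
determined and only the signs remain. -/
theorem slice_koszulD (α : Fin n →₀ ℕ) (c : KoszulSpace 𝕜 n) :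
    slice α (koszulD 𝕜 n c) = bd 𝕜 (slice α c) := by
  funext U
  rw [bd_apply]
  by_cases hU : U ⊆ α.support
  · have : koszulD 𝕜 n c U =
        ∑ v ∈ Uᶜ, (-1) ^ (U.filter (· < v)).card * (X v * c (insert v U)) := rfl
    rw [slice, if_pos hU, this, coeff_sum]
    refine Finset.sum_congr rfl fun v hv => ?_
    have hvU := Finset.mem_compl.1 hv
    have hC : ((-1 : MvPolynomial (Fin n) 𝕜)) ^ (U.filter (· < v)).card =
        C ((-1) ^ (U.filter (· < v)).card) := by simp
    rw [hC, coeff_C_mul, coeff_X_mul']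
    congr 1
    have hs : v ∈ (α - indicatorExp U).support ↔ insert v U ⊆ α.support := by
      rw [Finset.insert_subset_iff]
      simp [indicatorExp_apply, hvU, hU]
    simp only [slice, hs]
    split_ifs with h
    · rw [indicatorExp_insert hvU, tsub_add_eq_tsub_tsub]
    · rfl
  · rw [slice, if_neg hU]
    refine (Finset.sum_eq_zero fun v _ => ?_).symm
    rw [slice, if_neg fun h => hU ((Finset.subset_insert v U).trans h), mul_zero]

theorem eq_of_slice {c c' : KoszulSpace 𝕜 n} (h : ∀ α, slice α c = slice α c') : c = c' := by
  funext T
  ext β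
  have := congrFun (h (β + indicatorExp T)) T
  have hT : T ⊆ (β + indicatorExp T).support := by
    rw [← indicatorExp_le]
    exact le_add_self
  simpa [slice, hT] using this

/-- The sets that carry the multidegree `α` part of the Koszul complex of an edge ideal. -/
def multidegreeSets (G : SimpleGraph (Fin n)) (α : Fin n →₀ ℕ) : Set (Finset (Fin n)) :=
  {T | T ⊆ α.support ∧
    ∃ u v, G.Adj u v ∧ (α - indicatorExp T) u ≠ 0 ∧ (α - indicatorExp T) v ≠ 0}

theorem carriedBy_slice {G : SimpleGraph (Fin n)} {i j : ℕ} {c : KoszulSpace 𝕜 n}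
    (hc : c ∈ koszulChains (edgeIdeal 𝕜 G) i j) (α : Fin n →₀ ℕ) :
    CarriedBy (multidegreeSets G α) i (slice α c) := by
  intro T hT
  by_cases h : T ⊆ α.support
  · rw [slice, if_pos h] at hT
    obtain ⟨h1, h2, -⟩ := hc T
    refine ⟨⟨h, mem_edgeIdeal.1 h1 _ (mem_support_iff.2 hT)⟩, ?_⟩
    by_contra hne
    rw [h2 hne] at hT
    exact hT (coeff_zero _)
  · simp [slice, h] at hT

theorem slice_eq_zero {G : SimpleGraph (Fin n)} {i j : ℕ} {c : KoszulSpace 𝕜 n}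
    (hc : c ∈ koszulChains (edgeIdeal 𝕜 G) i j) {α : Fin n →₀ ℕ} (hα : α.degree ≠ j) :
    slice α c = 0 := by
  funext T
  by_contra hT
  have h := carriedBy_slice hc α T hT
  rw [slice, if_pos h.1.1] at hT
  have := (hc T).2.2 _ (mem_support_iff.2 hT)
  have h2 := congrArg Finsupp.degree (tsub_add_cancel_of_le (indicatorExp_le.2 h.1.1))
  rw [map_add, degree_indicatorExp, h.2] at h2
  omega

/-- If `α v ≥ 2`, dividing once by `x_v` does not change which variables occur, so `v` is a cone
point. Otherwise `α` is squarefree and the sets are the nonfaces on its support. -/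
theorem exactAt_multidegreeSets {G : SimpleGraph (Fin n)} {m i e : ℕ}
    (h : RegLE 𝕜 G m Set.univ) (he : m < e) {α : Fin n →₀ ℕ} (hα : α.degree = i + e) :
    ExactAt 𝕜 (multidegreeSets G α) i := by
  by_cases hsq : ∃ v, 2 ≤ α v
  · obtain ⟨v, hv⟩ := hsq
    refine ExactAt.of_cone v ?_ i
    rintro T ⟨hT, x, y, hxy, hx, hy⟩
    have key : ∀ x, (α - indicatorExp T) x ≠ 0 → (α - indicatorExp (insert v T)) x ≠ 0 := by
      intro x hx
      by_cases hxv : x = v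
      · subst hxv
        simp only [Finsupp.tsub_apply, indicatorExp_apply, Finset.mem_insert_self, if_true]
        omega
      · simpa [indicatorExp_apply, hxv] using hx
    refine ⟨Finset.insert_subset (Finsupp.mem_support_iff.2 (by omega)) hT, x, y, hxy,
      key x hx, key y hy⟩
  · push Not at hsq
    have hα' : α = indicatorExp α.support := by
      ext v
      rw [indicatorExp_apply]
      have := hsq v
      split_ifs with hv
      · have := Finsupp.mem_support_iff.1 hv
        omega
      · exact Finsupp.notMem_support_iff.1 hv
    have hcard : α.support.card = i + e := by
      rw [← hα, hα', degree_indicatorExp, support_indicatorExp]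
    have hE : multidegreeSets G α = nonfaces G α.support Set.univ := by
      ext T
      have key : ∀ x, (α - indicatorExp T) x ≠ 0 ↔ x ∈ α.support ∧ x ∉ T := by
        intro x
        have h2 := hsq x
        rw [Finsupp.mem_support_iff, Finsupp.tsub_apply, indicatorExp_apply]
        split_ifs with hx
        · simp only [hx, not_true_eq_false, and_false, iff_false]
          omega
        · simp [hx]
      simp only [multidegreeSets, nonfaces, Set.mem_ofPred_eq, key, Set.mem_univ,
        not_true_eq_false, and_false, exists_false, false_or]
      refine and_congr_right fun _ => ⟨?_, ?_⟩
      · rintro ⟨u, v, hadj, hu, hv⟩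
        exact ⟨u, hu.1, v, hv.1, hu.2, hv.2, hadj⟩
      · rintro ⟨u, hu, v, hv, huT, hvT, hadj⟩
        exact ⟨u, v, hadj, ⟨hu, huT⟩, hv, hvT⟩
    rw [hE]
    exact h _ (Set.subset_univ _) i (by omega)

/-- The Koszul chain with prescribed components in the multidegrees of total degree `j`. -/
noncomputable def assemble (j : ℕ) (B : (Fin n →₀ ℕ) → Finset (Fin n) → 𝕜) : KoszulSpace 𝕜 n :=
  fun T => ∑ α ∈ (Finset.univ : Finset (Fin n)).finsuppAntidiag j,
    if T ⊆ α.support then monomial (α - indicatorExp T) (B α T) else 0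

theorem mem_finsuppAntidiag_univ {j : ℕ} {α : Fin n →₀ ℕ} :
    α ∈ (Finset.univ : Finset (Fin n)).finsuppAntidiag j ↔ α.degree = j := by
  rw [Finset.mem_finsuppAntidiag, Finsupp.degree_eq_sum]
  simp

theorem slice_assemble {j : ℕ} {B : (Fin n →₀ ℕ) → Finset (Fin n) → 𝕜} {α : Fin n →₀ ℕ}
    (hB : ∀ T, B α T ≠ 0 → T ⊆ α.support) (hα : α.degree = j) :
    slice α (assemble j B) = B α := by
  funext T
  by_cases hT : T ⊆ α.support
  · rw [slice, if_pos hT, assemble, coeff_sum, Finset.sum_eq_single α]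
    · rw [if_pos hT, coeff_monomial, if_pos rfl]
    · intro α' _ hne
      split_ifs with hT'
      · rw [coeff_monomial, if_neg]
        intro h
        apply hne
        rw [← tsub_add_cancel_of_le (indicatorExp_le.2 hT'), h,
          tsub_add_cancel_of_le (indicatorExp_le.2 hT)]
      · exact coeff_zero _
    · intro h
      exact (h (mem_finsuppAntidiag_univ.2 hα)).elim
  · rw [slice, if_neg hT]
    by_contra h
    exact hT (hB T (Ne.symm h))

theorem assemble_mem_koszulChains {G : SimpleGraph (Fin n)} {i j : ℕ}
    {B : (Fin n →₀ ℕ) → Finset (Fin n) → 𝕜}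
    (hB : ∀ α, α.degree = j → CarriedBy (multidegreeSets G α) i (B α)) :
    assemble j B ∈ koszulChains (edgeIdeal 𝕜 G) i j := by
  classical
  intro T
  refine ⟨Ideal.sum_mem _ fun α hα => ?_, fun hT => Finset.sum_eq_zero fun α hα => ?_,
    fun m hm => ?_⟩
  · split_ifs with hT
    · by_cases h : B α T = 0
      · simp [h]
      · exact (monomial_mem_edgeIdeal h).2 (hB α (mem_finsuppAntidiag_univ.1 hα) T h).1.2
    · exact Ideal.zero_mem _
  · have : B α T = 0 := by
      by_contra h
      exact hT (hB α (mem_finsuppAntidiag_univ.1 hα) T h).2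
    simp [this]
  · obtain ⟨α, hα, hm'⟩ := Finset.mem_biUnion.1 (support_sum hm)
    split_ifs at hm' with hT
    · rw [support_monomial] at hm'
      split_ifs at hm' with hB0
      · simp at hm'
      · have hdeg := mem_finsuppAntidiag_univ.1 hα
        have hcard := (hB α hdeg T hB0).2
        rw [Finset.mem_singleton] at hm'
        have h2 := congrArg Finsupp.degree (tsub_add_cancel_of_le (indicatorExp_le.2 hT))
        rw [map_add, degree_indicatorExp, ← hm'] at h2
        omega
    · simp at hm'

theorem subsingleton_gradedTor {G : SimpleGraph (Fin n)} {m i e : ℕ}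
    (h : RegLE 𝕜 G m Set.univ) (he : m < e) :
    Subsingleton (GradedTor (edgeIdeal 𝕜 G) i (i + e)) := by
  rw [Submodule.Quotient.subsingleton_iff, Submodule.submoduleOf, Submodule.comap_subtype_eq_top]
  rintro c ⟨hc, hcyc⟩
  have hcyc' : koszulD 𝕜 n c = 0 := hcyc
  have hex : ∀ α : Fin n →₀ ℕ, ∃ b, α.degree = i + e →
      CarriedBy (multidegreeSets G α) (i + 1) b ∧ bd 𝕜 b = slice α c := by
    intro α
    by_cases hα : α.degree = i + e
    · obtain ⟨b, hb⟩ := exactAt_multidegreeSets h he hα (slice α c) (carriedBy_slice hc α) (by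
        rw [← slice_koszulD, hcyc']
        funext T
        simp [slice])
      exact ⟨b, fun _ => hb⟩
    · exact ⟨0, fun h => (hα h).elim⟩
  choose B hB using hex
  have hmem : assemble (i + e) B ∈ koszulChains (edgeIdeal 𝕜 G) (i + 1) (i + e) :=
    assemble_mem_koszulChains fun α hα => (hB α hα).1
  refine ⟨assemble (i + e) B, hmem, eq_of_slice fun α => ?_⟩
  rw [slice_koszulD]
  by_cases hα : α.degree = i + e
  · rw [slice_assemble (fun T hT => ((hB α hα).1 T hT).1.1) hα, (hB α hα).2]
  · rw [slice_eq_zero hmem hα, slice_eq_zero hc hα, map_zero]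

theorem nontrivial_gradedTor {G : SimpleGraph (Fin n)} {S : Finset (Fin n)} {i e : ℕ}
    (hS : S.card = i + e) (h : ¬ ExactAt 𝕜 (nonfaces G S Set.univ) i) :
    Nontrivial (GradedTor (edgeIdeal 𝕜 G) i (i + e)) := by
  rw [← not_subsingleton_iff_nontrivial]
  intro hs
  apply h
  rw [Submodule.Quotient.subsingleton_iff, Submodule.submoduleOf,
    Submodule.comap_subtype_eq_top] at hs
  have hsets : multidegreeSets G (indicatorExp S) = nonfaces G S Set.univ := by
    ext T
    have key : ∀ x, (indicatorExp S - indicatorExp T) x ≠ 0 ↔ x ∈ S ∧ x ∉ T := by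
      intro x
      rw [Finsupp.tsub_apply, indicatorExp_apply, indicatorExp_apply]
      by_cases h1 : x ∈ S <;> by_cases h2 : x ∈ T <;> simp [h1, h2]
    simp only [multidegreeSets, nonfaces, Set.mem_ofPred_eq, key, Set.mem_univ,
      not_true_eq_false, and_false, exists_false, false_or, support_indicatorExp]
    refine and_congr_right fun _ => ⟨?_, ?_⟩
    · rintro ⟨u, v, hadj, hu, hv⟩
      exact ⟨u, hu.1, v, hv.1, hu.2, hv.2, hadj⟩
    · rintro ⟨u, hu, v, hv, huT, hvT, hadj⟩
      exact ⟨u, v, hadj, ⟨hu, huT⟩, hv, hvT⟩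
  have hdeg : (indicatorExp S).degree = i + e := by rw [degree_indicatorExp, hS]
  intro c hc hcyc
  classical
  set B : (Fin n →₀ ℕ) → Finset (Fin n) → 𝕜 := fun α => if α = indicatorExp S then c else 0
    with hB
  have hBS : B (indicatorExp S) = c := by simp [hB]
  have hmem : assemble (i + e) B ∈ koszulChains (edgeIdeal 𝕜 G) i (i + e) := by
    refine assemble_mem_koszulChains fun α _ => ?_
    by_cases hα : α = indicatorExp S
    · rw [hα, hBS, hsets]
      exact hc
    · simp only [hB, if_neg hα]
      exact CarriedBy.zero _ _
  have hsl : ∀ α, α.degree = i + e → slice α (assemble (i + e) B) = B α := by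
    intro α hα
    refine slice_assemble (fun T hT => ?_) hα
    by_cases hα' : α = indicatorExp S
    · rw [hα', hBS] at hT
      rw [hα', support_indicatorExp]
      exact (hc T hT).1.1
    · simp [hB, hα'] at hT
  obtain ⟨b, hb, hbd⟩ := hs ⟨hmem, by
    rw [SetLike.mem_coe, LinearMap.mem_ker]
    refine eq_of_slice fun α => ?_
    have h0 : slice α (0 : KoszulSpace 𝕜 n) = 0 := by
      funext T
      simp [slice]
    rw [slice_koszulD, h0]
    by_cases hα : α.degree = i + e
    · rw [hsl α hα]
      by_cases hα' : α = indicatorExp S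
      · rw [hα', hBS, hcyc]
      · simp [hB, hα']
    · rw [slice_eq_zero hmem hα, map_zero]⟩
  refine ⟨slice (indicatorExp S) b, hsets ▸ carriedBy_slice hb _, ?_⟩
  rw [← slice_koszulD, hbd, hsl _ hdeg, hBS]

theorem reg_le {G : SimpleGraph (Fin n)} {m : ℕ} (h : RegLE 𝕜 G m Set.univ) :
    reg (edgeIdeal 𝕜 G) ≤ ((m : ℕ∞) : WithBot ℕ∞) := by
  refine sSup_le ?_
  rintro d ⟨i, e, hne, rfl⟩
  have : e ≤ m := by
    by_contra hlt
    have hs := subsingleton_gradedTor (i := i) h (not_le.1 hlt)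
    exact not_subsingleton_iff_nontrivial.2 hne hs
  exact_mod_cast this

theorem le_reg {G : SimpleGraph (Fin n)} {S : Finset (Fin n)} {i e : ℕ}
    (hS : S.card = i + e) (h : ¬ ExactAt 𝕜 (nonfaces G S Set.univ) i) :
    ((e : ℕ∞) : WithBot ℕ∞) ≤ reg (edgeIdeal 𝕜 G) :=
  le_sSup ⟨i, e, nontrivial_gradedTor hS h, rfl⟩

theorem two_le_reg {G : SimpleGraph (Fin n)} {u v : Fin n} (h : G.Adj u v) :
    2 ≤ reg (edgeIdeal 𝕜 G) := by
  have := le_reg (i := 0) (e := 2) (by rw [Finset.card_pair h.ne]) (not_exactAt_of_adj 𝕜 h)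
  exact_mod_cast this

end Algebra

/-! ### Graphs generated by increasing maps: adjacency patterns. -/

section Shift

/-- The graph `G` is obtained from the edges `i < j` of a graph on `r` vertices, given by `D`, by
applying all increasing maps in `Inc r n`. -/
def IsShiftGraph (D : ℕ → ℕ → Prop) (r : ℕ) {n : ℕ} (G : SimpleGraph (Fin n)) : Prop :=
  ∀ a b : Fin n, a < b → (G.Adj a b ↔
    ∃ i j, D i j ∧ i ≤ a ∧ j + (a : ℕ) ≤ b + i ∧ (b : ℕ) + r ≤ n + j)

/-- `D` is a nonempty set of pairs `i < j < r`, whose least left end is `p` and whose greatest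
right end is `q`. -/
structure EdgeData (D : ℕ → ℕ → Prop) (r p q : ℕ) : Prop where
  lt : ∀ {i j}, D i j → i < j
  lt_r : ∀ {i j}, D i j → j < r
  p_le : ∀ {i j}, D i j → p ≤ i
  exists_p : ∃ j, D p j
  le_q : ∀ {i j}, D i j → j ≤ q
  exists_q : ∃ i, D i q

/-- The vertices that are not isolated for obvious reasons. -/
def core (n r p q : ℕ) : Set (Fin n) := {v | p ≤ (v : ℕ) ∧ (v : ℕ) + r ≤ n + q}

theorem forall_not_adj_of_lt {n : ℕ} {G : SimpleGraph (Fin n)} {A : Set (Fin n)}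
    (h : ∀ x ∈ A, ∀ y ∈ A, x < y → ¬ G.Adj x y) : ∀ x ∈ A, ∀ y ∈ A, ¬ G.Adj x y := by
  intro x hx y hy hadj
  rcases lt_trichotomy x y with hlt | rfl | hlt
  · exact h x hx y hy hlt hadj
  · exact hadj.ne rfl
  · exact h y hy x hx hlt hadj.symm

variable {D : ℕ → ℕ → Prop} {r p q n : ℕ} {G : SimpleGraph (Fin n)}

theorem IsShiftGraph.adj (hG : IsShiftGraph D r G) (hD : EdgeData D r p q) {i j : ℕ}
    (hij : D i j) {a b : Fin n} (h₁ : i ≤ a) (h₂ : j + (a : ℕ) ≤ b + i)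
    (h₃ : (b : ℕ) + r ≤ n + j) : G.Adj a b := by
  have := hD.lt hij
  exact (hG a b (Fin.lt_def.2 (by omega))).2 ⟨i, j, hij, h₁, h₂, h₃⟩

theorem mem_core_of_adj (hG : IsShiftGraph D r G) (hD : EdgeData D r p q) {a b : Fin n}
    (h : G.Adj a b) : a ∈ core n r p q := by
  rcases lt_or_gt_of_ne h.ne with hlt | hlt
  · obtain ⟨i, j, hij, h1, h2, h3⟩ := (hG a b hlt).1 h
    have := hD.p_le hij
    have := hD.le_q hij
    have := Fin.lt_def.1 hlt
    exact ⟨by omega, by omega⟩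
  · obtain ⟨i, j, hij, h1, h2, h3⟩ := (hG b a hlt).1 h.symm
    have := hD.p_le hij
    have := hD.le_q hij
    have := Fin.lt_def.1 hlt
    exact ⟨by omega, by omega⟩

/-- Distance `r` exceeds the length of every edge in `D`, so only the end conditions matter. If `a ≥
r`, an edge ending in `q` produces `ab`; if `b ≤ n - r`, an edge starting in `p` does. -/
theorem ends_of_not_adj_of_long (hG : IsShiftGraph D r G) (hD : EdgeData D r p q) {a b : Fin n}
    (ha : a ∈ core n r p q) (hb : b ∈ core n r p q) (h : ¬ G.Adj a b) (hab : (a : ℕ) + r ≤ b) :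
    (a : ℕ) < r ∧ n < (b : ℕ) + r := by
  obtain ⟨j, hj⟩ := hD.exists_p
  obtain ⟨i, hi⟩ := hD.exists_q
  have := hD.lt hj
  have := hD.lt_r hj
  have := hD.lt hi
  have := hD.lt_r hi
  have ha1 := ha.1
  have hb2 := hb.2
  constructor
  · by_contra hlt
    exact h (hG.adj hD hi (by omega) (by omega) (by omega))
  · by_contra hlt
    exact h (hG.adj hD hj (by omega) (by omega) (by omega))

/-- Non-neighbours to the left of a vertex that is not close to the right end. -/
theorem not_adj_left (hG : IsShiftGraph D r G) (hD : EdgeData D r p q) {a b v : Fin n}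
    (hbv : b < v) (hv : (v : ℕ) + r ≤ n) (h : ¬ G.Adj a v) (hab : a < b) : ¬ G.Adj a b := by
  intro hadj
  obtain ⟨i, j, hij, h1, h2, h3⟩ := (hG a b hab).1 hadj
  have := Fin.lt_def.1 hbv
  exact h (hG.adj hD hij h1 (by omega) (by omega))

/-- Non-neighbours to the right of a vertex that is not close to the left end. -/
theorem not_adj_right (hG : IsShiftGraph D r G) (hD : EdgeData D r p q) {a b v : Fin n}
    (hva : v < a) (hv : r ≤ v) (h : ¬ G.Adj v b) (hab : a < b) : ¬ G.Adj a b := by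
  intro hadj
  obtain ⟨i, j, hij, h1, h2, h3⟩ := (hG a b hab).1 hadj
  have := Fin.lt_def.1 hva
  have := hD.lt hij
  have := hD.lt_r hij
  exact h (hG.adj hD hij (by omega) (by omega) h3)

/-- Non-neighbours across a long distance are nested, on the left. -/
theorem not_adj_of_le_left (hG : IsShiftGraph D r G) (hD : EdgeData D r p q) {a v b : Fin n}
    (hav : a ≤ v) (hvb : (v : ℕ) + r ≤ b) (h : ¬ G.Adj v b) : ¬ G.Adj a b := by
  intro hadj
  have hav' := Fin.le_def.1 hav
  obtain ⟨i, j, hij, h1, h2, h3⟩ := (hG a b (Fin.lt_def.2 (by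
    have := a.2
    have : 0 < r := by
      obtain ⟨j, hj⟩ := hD.exists_p
      have := hD.lt_r hj
      omega
    omega))).1 hadj
  have := hD.lt_r hij
  exact h (hG.adj hD hij (by omega) (by omega) h3)

/-- Non-neighbours across a long distance are nested, on the right. -/
theorem not_adj_of_le_right (hG : IsShiftGraph D r G) (hD : EdgeData D r p q) {a b w : Fin n}
    (hbw : b ≤ w) (hab : (a : ℕ) + r ≤ b) (h : ¬ G.Adj a b) : ¬ G.Adj a w := by
  intro hadj
  have hbw' := Fin.le_def.1 hbw
  obtain ⟨i, j, hij, h1, h2, h3⟩ := (hG a w (Fin.lt_def.2 (by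
    have : 0 < r := by
      obtain ⟨j, hj⟩ := hD.exists_p
      have := hD.lt_r hj
      omega
    omega))).1 hadj
  have := hD.lt_r hij
  exact h (hG.adj hD hij h1 (by omega) (by omega))

/-! ### Upper bounds for the regularity. -/

variable (𝕜 : Type*) [Field 𝕜]

theorem sub_val_injective : Function.Injective (fun v : Fin n => n - (v : ℕ)) := by
  intro a b h
  have := a.2
  have := b.2
  have h' : n - (a : ℕ) = n - (b : ℕ) := h
  exact Fin.ext (by omega)

/-- Fröberg's argument: by `not_adj_left` the earlier non-neighbours of a vertex are pairwise
non-adjacent, so the natural order is a perfect elimination order of the complement graph.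
`regLE_right` is the mirror image, with rank `n - v`. -/
theorem regLE_left (hG : IsShiftGraph D r G) (hD : EdgeData D r p q) :
    RegLE 𝕜 G 2 {v | (v : ℕ) + r ≤ n} := by
  refine RegLE.of_elimination (m := 0) _ Fin.val_injective Finset.univ
    (RegLE.of_indep fun x hx => (hx.2 (Finset.mem_univ x)).elim) fun v _ hv => ?_
  refine RegLE.of_indep (forall_not_adj_of_lt ?_)
  rintro x ⟨-, hxv, -⟩ y ⟨-, -, hy⟩ hxy
  have hyv : y < v := hy.resolve_left fun h => h (Finset.mem_univ y)
  exact not_adj_left hG hD hyv hv hxv hxy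

theorem regLE_right (hG : IsShiftGraph D r G) (hD : EdgeData D r p q) :
    RegLE 𝕜 G 2 {v | r ≤ (v : ℕ)} := by
  refine RegLE.of_elimination (m := 0) _ sub_val_injective Finset.univ
    (RegLE.of_indep fun x hx => (hx.2 (Finset.mem_univ x)).elim) fun v _ hv => ?_
  refine RegLE.of_indep (forall_not_adj_of_lt ?_)
  rintro x ⟨-, -, hx⟩ y ⟨-, hyv, -⟩ hxy
  have hvx : v < x := by
    have := hx.resolve_left fun h => h (Finset.mem_univ x)
    exact Fin.lt_def.2 (by omega)
  exact not_adj_right hG hD hvx hv (fun h => hyv h.symm) hxy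

theorem regLE_univ_of_core (hG : IsShiftGraph D r G) (hD : EdgeData D r p q) {m : ℕ}
    (h : RegLE 𝕜 G m (core n r p q)) : RegLE 𝕜 G m Set.univ :=
  h.of_isolated fun _ _ hx _ _ hadj => hx (mem_core_of_adj hG hD hadj)

/-- The core non-neighbours of a middle vertex `r ≤ v ≤ n - 2r` avoid the right end, so `regLE_left`
bounds them by 2. Once the middle is gone, the two remaining sides are at distance at least `r`; the
non-neighbours of a left vertex `v` that lie to its left are then isolated, leaving a graph covered
by `regLE_right`. -/
theorem regLE_three (hG : IsShiftGraph D r G) (hD : EdgeData D r p q) (hn : 4 * r ≤ n) :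
    RegLE 𝕜 G 3 Set.univ := by
  classical
  refine regLE_univ_of_core 𝕜 hG hD ?_
  have hr : 0 < r := by
    obtain ⟨j, hj⟩ := hD.exists_p
    have := hD.lt_r hj
    omega
  refine RegLE.of_elimination (m := 1) _ Fin.val_injective
    (Finset.univ.filter fun v : Fin n => r ≤ (v : ℕ) ∧ (v : ℕ) + 2 * r ≤ n) ?_ ?_
  swap
  · intro v hvM hv
    have hvM' : r ≤ (v : ℕ) ∧ (v : ℕ) + 2 * r ≤ n := by simpa using hvM
    refine (regLE_left 𝕜 hG hD).mono le_rfl ?_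
    rintro x ⟨hx, hxv, -⟩
    by_contra hlt
    have hlt' : n < (x : ℕ) + r := not_le.1 hlt
    have := ends_of_not_adj_of_long hG hD hv hx (fun h => hxv h.symm) (by omega)
    omega
  · refine RegLE.of_elimination (m := 1) _ Fin.val_injective
      (Finset.univ.filter fun v : Fin n => (v : ℕ) < r) ?_ ?_
    · refine (regLE_right 𝕜 hG hD).mono (by omega) ?_
      rintro x ⟨-, hx⟩
      simpa using hx
    · intro v hvM hv
      have hvr : (v : ℕ) < r := by simpa using hvM
      refine ((regLE_right 𝕜 hG hD).mono le_rfl subset_rfl).of_isolated ?_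
      have key : ∀ x ∈ core n r p q,
          (x ∉ Finset.univ.filter fun v : Fin n => r ≤ (v : ℕ) ∧ (v : ℕ) + 2 * r ≤ n) →
          r ≤ (x : ℕ) → (v : ℕ) + r ≤ x := by
        intro x _ hxM hxr
        have : r ≤ (x : ℕ) → n < (x : ℕ) + 2 * r := by simpa using hxM
        have := this hxr
        omega
      rintro x ⟨⟨hx, hxM⟩, hxv, hxlt⟩ hxr y ⟨⟨hy, hyM⟩, hyv, hylt⟩ hadj
      have hxr' : (x : ℕ) < r := not_le.1 hxr
      have hxv' : x < v := hxlt.resolve_left fun h => h (by simpa using hxr')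
      by_cases hyr : (y : ℕ) < r
      · have hyv' : y < v := hylt.resolve_left fun h => h (by simpa using hyr)
        rcases lt_or_gt_of_ne hadj.ne with hlt | hlt
        · exact not_adj_left hG hD hyv' (by omega) hxv hlt hadj
        · exact not_adj_left hG hD hxv' (by omega) hyv hlt hadj.symm
      · exact not_adj_of_le_left hG hD hxv'.le (key y hy hyM (not_lt.1 hyr))
          (fun h => hyv h.symm) hadj

/-- The edge `pq` makes all core vertices at distance at least `r` adjacent. With `d` the least
length of an edge in `D`, the core is cut into two overlapping pieces. The overlap has `d - 1`
consecutive positions, hence is independent, while vertices on opposite sides of it are at distance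
at least `d` and adjacent. Each piece misses one end, so `RegLE.union` applies. -/
theorem regLE_two_of_rect (hG : IsShiftGraph D r G) (hD : EdgeData D r p q) (hn : 4 * r ≤ n)
    (hpq : D p q) : RegLE 𝕜 G 2 Set.univ := by
  classical
  have hex : ∃ d, ∃ i, D i (i + d) := ⟨q - p, p, by
    rwa [Nat.add_sub_cancel' (hD.lt hpq).le]⟩
  obtain ⟨i₀, hi₀⟩ := Nat.find_spec hex
  have hmin : ∀ {i j}, D i j → Nat.find hex + i ≤ j := by
    intro i j hij
    have := hD.lt hij
    have := Nat.find_min' hex ⟨i, by rwa [Nat.add_sub_cancel' this.le]⟩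
    omega
  set d := Nat.find hex with hd
  have hd0 := hD.lt hi₀
  have hdr := hD.lt_r hi₀
  refine regLE_univ_of_core 𝕜 hG hD ?_
  have hA : RegLE 𝕜 G 2 {v | v ∈ core n r p q ∧ (v : ℕ) + 1 < 2 * r + d} :=
    (regLE_left 𝕜 hG hD).mono le_rfl fun x hx => by
      have := hx.2
      change (x : ℕ) + r ≤ n
      omega
  have hB : RegLE 𝕜 G 2 {v | v ∈ core n r p q ∧ 2 * r ≤ (v : ℕ)} :=
    (regLE_right 𝕜 hG hD).mono le_rfl fun x hx => by
      have := hx.2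
      change r ≤ (x : ℕ)
      omega
  refine (RegLE.union hA hB (forall_not_adj_of_lt ?_) ?_).mono le_rfl ?_
  · rintro x ⟨-, -, hx⟩ y ⟨⟨-, hy⟩, -⟩ hxy hadj
    obtain ⟨i, j, hij, h1, h2, h3⟩ := (hG x y hxy).1 hadj
    have := hmin hij
    omega
  · rintro x ⟨hx, hx1⟩ hxB y ⟨hy, hy1⟩ hyA
    have hx2 : (x : ℕ) < 2 * r := by
      by_contra h
      exact hxB ⟨hx, not_lt.1 h⟩
    have hy2 : 2 * r + d ≤ (y : ℕ) + 1 := by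
      by_contra h
      exact hyA ⟨hy, not_le.1 h⟩
    have hx3 := hx.1
    have hy3 := hy.2
    by_cases hlong : (x : ℕ) + r ≤ y
    · have := hD.lt_r hpq
      exact hG.adj hD hpq hx3 (by omega) hy3
    · exact hG.adj hD hi₀ (by omega) (by omega) (by omega)
  · intro x hx
    by_cases h : 2 * r ≤ (x : ℕ)
    · exact Or.inr ⟨hx, h⟩
    · exact Or.inl ⟨hx, by omega⟩

/-- Two disjoint edges form an induced subgraph. -/
def HasInducedPair {V : Type*} (G : SimpleGraph V) : Prop :=
  ∃ x x' y y', G.Adj x x' ∧ G.Adj y y' ∧ ¬ G.Adj x y ∧ ¬ G.Adj x y' ∧ ¬ G.Adj x' y ∧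
    ¬ G.Adj x' y'

/-- A perfect elimination of the complement again. The edge of length 1 makes non-adjacent core
vertices on opposite sides of the cut `2r` lie far apart, and then the right non-neighbours of left
vertices shrink as the vertex moves right (`hanti`). Left vertices satisfying `Q` are removed from
right to left, then the right half from left to right. -/
theorem regLE_two_of_short (hG : IsShiftGraph D r G) (hD : EdgeData D r p q) (hn : 4 * r ≤ n)
    {i₀ : ℕ} (hi₀ : D i₀ (i₀ + 1)) (hpair : ¬ HasInducedPair G) : RegLE 𝕜 G 2 Set.univ := by
  classical
  refine regLE_univ_of_core 𝕜 hG hD ?_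
  have hir := hD.lt_r hi₀
  have hlong : ∀ a ∈ core n r p q, ∀ b ∈ core n r p q, (a : ℕ) < 2 * r → 2 * r ≤ (b : ℕ) →
      ¬ G.Adj a b → (a : ℕ) + r ≤ b := by
    intro a ha b hb ha' hb' hab
    by_contra hlt
    exact hab (hG.adj hD hi₀ (by omega) (by omega) (by omega))
  -- the vertices whose non-neighbours in the right half form a clique of the complement
  set Q : Fin n → Prop := fun v => ∀ b ∈ core n r p q, ∀ b' ∈ core n r p q, 2 * r ≤ (b : ℕ) →
    2 * r ≤ (b' : ℕ) → ¬ G.Adj v b → ¬ G.Adj v b' → ¬ G.Adj b b' with hQ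
  have hanti : ∀ a v b : Fin n, v ∈ core n r p q → b ∈ core n r p q → (v : ℕ) < 2 * r →
      2 * r ≤ (b : ℕ) → a ≤ v → ¬ G.Adj v b → ¬ G.Adj a b := by
    intro a v b hv hb hv' hb' hav hvb
    exact not_adj_of_le_left hG hD hav (hlong v hv b hb hv' hb' hvb) hvb
  refine RegLE.of_elimination (m := 0) _ Fin.val_injective
    (Finset.univ.filter fun v : Fin n => (v : ℕ) < 2 * r ∧ Q v) ?_ ?_
  swap
  · intro v hvM hv
    obtain ⟨hv2, hvQ⟩ : (v : ℕ) < 2 * r ∧ Q v := by simpa using hvM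
    -- By `hanti`, `Q` passes from `v` to all left-half vertices after `v`, so these have already
    -- been removed.
    have hcase : ∀ x ∈ core n r p q, ¬ G.Adj x v →
        (x ∉ (Finset.univ.filter fun v : Fin n => (v : ℕ) < 2 * r ∧ Q v) ∨ (x : ℕ) < v) →
        x < v ∨ 2 * r ≤ (x : ℕ) := by
      intro x hx hxv h
      rcases h with h | h
      · by_contra hcon
        rw [not_or, not_lt, not_le] at hcon
        apply h
        simp only [Finset.mem_filter, Finset.mem_univ, true_and]
        refine ⟨hcon.2, fun b hb b' hb' h1 h2 h3 h4 => ?_⟩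
        exact hvQ b hb b' hb' h1 h2 (hanti v x b hx hb hcon.2 h1 hcon.1 h3)
          (hanti v x b' hx hb' hcon.2 h2 hcon.1 h4)
      · exact Or.inl h
    refine RegLE.of_indep (forall_not_adj_of_lt ?_)
    rintro x ⟨hx, hxv, hxM⟩ y ⟨hy, hyv, hyM⟩ hxy
    rcases hcase x hx hxv hxM with hx' | hx'
    · rcases hcase y hy hyv hyM with hy' | hy'
      · exact not_adj_left hG hD hy' (by omega) hxv hxy
      · exact hanti x v y hv hy hv2 hy' hx'.le fun h => hyv h.symm
    · have := Fin.lt_def.1 hxy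
      exact hvQ x hx y hy hx' (by omega) (fun h => hxv h.symm) fun h => hyv h.symm
  · refine RegLE.of_elimination (m := 0) _ sub_val_injective
      (Finset.univ.filter fun v : Fin n => 2 * r ≤ (v : ℕ)) ?_ ?_
    -- Left vertices failing `Q` are independent: if `xy` were an edge with `x < y`, the edge among
    -- right non-neighbours of `y` would avoid the neighbours of `x` too, giving an induced pair.
    all_goals
      have hC : ∀ x ∈ {x ∈ core n r p q | x ∉ Finset.univ.filter fun v : Fin n =>
          (v : ℕ) < 2 * r ∧ Q v}, ∀ y ∈ {x ∈ core n r p q | x ∉ Finset.univ.filter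
          fun v : Fin n => (v : ℕ) < 2 * r ∧ Q v}, (y : ℕ) < 2 * r → x < y → ¬ G.Adj x y := by
        rintro x ⟨hx, -⟩ y ⟨hy, hyM⟩ hy2 hxy hadj
        have hyQ : ¬ Q y := fun h => hyM (by simpa using ⟨hy2, h⟩)
        simp only [hQ, not_forall, not_not] at hyQ
        obtain ⟨b, hb, b', hb', h1, h2, h3, h4, h5⟩ := hyQ
        exact hpair ⟨x, y, b, b', hadj, h5, hanti x y b hy hb hy2 h1 hxy.le h3,
          hanti x y b' hy hb' hy2 h2 hxy.le h4, h3, h4⟩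
    · refine RegLE.of_indep (forall_not_adj_of_lt ?_)
      rintro x ⟨hx, -⟩ y ⟨hy, hyM⟩ hxy
      exact hC x hx y hy (by simpa using hyM) hxy
    · intro b hbM hb
      have hb2 : 2 * r ≤ (b : ℕ) := by simpa using hbM
      have hcase : ∀ x : Fin n, (x ∉ (Finset.univ.filter fun v : Fin n => 2 * r ≤ (v : ℕ)) ∨
          n - (x : ℕ) < n - (b : ℕ)) → (x : ℕ) < 2 * r ∨ b < x := by
        intro x h
        rcases h with h | h
        · left
          simpa using h
        · right
          exact Fin.lt_def.2 (by omega)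
      refine RegLE.of_indep (forall_not_adj_of_lt ?_)
      rintro x ⟨hx, hxb, hxM⟩ y ⟨hy, hyb, hyM⟩ hxy
      have hxy' := Fin.lt_def.1 hxy
      rcases hcase y hyM with hy' | hy'
      · exact hC x hx y hy hy' hxy
      · rcases hcase x hxM with hx' | hx'
        · exact not_adj_of_le_right hG hD hy'.le (hlong x hx.1 b hb.1 hx' hb2 hxb) hxb
        · exact not_adj_right hG hD hx' (by omega) (fun h => hyb h.symm) hxy

/-! ### Lower bounds for the regularity. -/

theorem three_le_reg_of_inducedPair (h : HasInducedPair G) : 3 ≤ reg (edgeIdeal 𝕜 G) := by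
  obtain ⟨x, x', y, y', hx, hy, h1, h2, h3, h4⟩ := h
  have n1 := hx.ne
  have n2 := hy.ne
  have n3 : x ≠ y := by rintro rfl; exact h3 hx.symm
  have n4 : x ≠ y' := by rintro rfl; exact h4 hx.symm
  have n5 : x' ≠ y := by rintro rfl; exact h1 hx
  have n6 : x' ≠ y' := by rintro rfl; exact h2 hx
  have hcard : ({x, x', y, y'} : Finset (Fin n)).card = 1 + 3 := by
    rw [Finset.card_insert_of_notMem (by simp [*]), Finset.card_insert_of_notMem (by simp [*]),
      Finset.card_pair n2]
  -- The non-edges form the 4-cycle `x, y', x', y`; the chosen non-edge is `xy` and the path is the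
  -- rest of the cycle.
  have := le_reg (𝕜 := 𝕜) (G := G) hcard (not_exactAt_of_path 𝕜 (u := x) (w := y) (by simp) (by simp)
    n3 h1 (by
      intro z hz hzx hzy
      simp only [Finset.mem_insert, Finset.mem_singleton] at hz
      rcases hz with rfl | rfl | rfl | rfl
      · exact (hzx rfl).elim
      · exact Or.inl hx
      · exact (hzy rfl).elim
      · exact Or.inr hy) (by
      refine .tail (b := x') (.tail (b := y') (.single ?_) ?_) ?_
      · exact ⟨by simp, by simp, n4, h2, fun h => n2 h.2.symm, fun h => n3 h.1⟩
      · exact ⟨by simp, by simp, n6.symm, fun h => h4 h.symm, fun h => n4 h.1.symm,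
          fun h => n2 h.1.symm⟩
      · exact ⟨by simp, by simp, n5, h3, fun h => n1 h.1.symm, fun h => n5 h.1⟩)
    hcard.symm)
  exact_mod_cast this

/-- Without edges of length 1, consecutive vertices are non-adjacent, so an interval carries a path
of non-edges between its ends. It closes up to a cycle when the ends `u, w` are a non-adjacent core
pair at distance at least `r`; choosing the closest such pair excludes common non-neighbours. -/
theorem three_le_reg_of_no_short (hG : IsShiftGraph D r G) (hD : EdgeData D r p q)
    (hn : 4 * r ≤ n) (hpq : ¬ D p q) (hshort : ∀ i, ¬ D i (i + 1)) :
    3 ≤ reg (edgeIdeal 𝕜 G) := by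
  classical
  obtain ⟨j₀, hj₀⟩ := hD.exists_p
  obtain ⟨i₀, hi₀⟩ := hD.exists_q
  have a1 := hD.lt hj₀
  have a2 := hD.lt_r hj₀
  have a3 := hD.lt_r hi₀
  have hex : ∃ d, ∃ a b : Fin n, a ∈ core n r p q ∧ b ∈ core n r p q ∧ ¬ G.Adj a b ∧
      (a : ℕ) + r ≤ b ∧ (b : ℕ) = a + d := by
    -- The first and the last core vertex: an edge between them could only come from the pair `(p,
    -- q)`, which is not in `D`.
    refine ⟨n + q - r - p, ⟨p, by omega⟩, ⟨n + q - r, by omega⟩, ⟨le_rfl, ?_⟩, ⟨?_, ?_⟩, ?_, ?_, ?_⟩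
    · change p + r ≤ n + q
      omega
    · change p ≤ n + q - r
      omega
    · change n + q - r + r ≤ n + q
      omega
    · intro hadj
      obtain ⟨i, j, hij, h1, h2, h3⟩ := (hG _ _ (Fin.lt_def.2 (by simp only; omega))).1 hadj
      have b1 := hD.p_le hij
      have b2 := hD.le_q hij
      simp only at h1 h2 h3
      have e1 : i = p := by omega
      have e2 : j = q := by omega
      subst e1 e2
      exact hpq hij
    · simp only
      omega
    · simp only
      omega
  obtain ⟨u, w, hu, hw, hadj, huw, hd⟩ := Nat.find_spec hex
  have hends := ends_of_not_adj_of_long hG hD hu hw hadj huw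
  have hmin : ∀ a b : Fin n, a ∈ core n r p q → b ∈ core n r p q → ¬ G.Adj a b →
      (b : ℕ) - a < w - u → (b : ℕ) < a + r := by
    intro a b ha hb hab hlt
    by_contra hge
    have := Nat.find_min' hex ⟨a, b, ha, hb, hab, not_lt.1 hge, (Nat.add_sub_cancel' (by omega)).symm⟩
    omega
  have hu1 := hu.1
  have hw2 := hw.2
  have hcard : (Finset.Icc u w).card = ((Finset.Icc u w).card - 3) + 3 := by
    rw [Fin.card_Icc]
    omega
  have hw' : w ∈ Finset.Icc u w := Finset.mem_Icc.2 ⟨Fin.le_def.2 (by omega), le_rfl⟩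
  have hu' : u ∈ Finset.Icc u w := Finset.mem_Icc.2 ⟨le_rfl, Fin.le_def.2 (by omega)⟩
  have hne : u ≠ w := by
    rintro rfl
    omega
  have := le_reg (𝕜 := 𝕜) (G := G) hcard (not_exactAt_of_path 𝕜 hu' hw' hne hadj (by
      intro x hx hxu hxw
      obtain ⟨hx1, hx2⟩ := Finset.mem_Icc.1 hx
      have hx1' := Fin.lt_def.1 (lt_of_le_of_ne hx1 (Ne.symm hxu))
      have hx2' := Fin.lt_def.1 (lt_of_le_of_ne hx2 hxw)
      have hxc : x ∈ core n r p q := ⟨by omega, by omega⟩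
      -- By minimality a common non-neighbour would be within `r` of both ends, but `u < r` and `w >
      -- n - r ≥ 3r`.
      by_contra hcon
      rw [not_or] at hcon
      have := hmin u x hu hxc hcon.1 (by omega)
      have := hmin x w hxc hw (fun h => hcon.2 h.symm) (by omega)
      omega) (by
      have key : ∀ d (y : Fin n), (y : ℕ) = u + d → y ≤ w → Relation.ReflTransGen
          (fun x y => x ∈ Finset.Icc u w ∧ y ∈ Finset.Icc u w ∧ x ≠ y ∧ ¬ G.Adj x y ∧
            ¬ (x = u ∧ y = w) ∧ ¬ (x = w ∧ y = u)) u y := by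
        intro d
        induction d with
        | zero =>
          intro y hy _
          have : y = u := Fin.ext (by omega)
          rw [this]
        | succ d ih =>
          intro y hy hyw
          have hyw' := Fin.le_def.1 hyw
          have hyn := y.2
          refine .tail (ih ⟨u + d, by omega⟩ rfl (Fin.le_def.2 (by simp only; omega))) ?_
          refine ⟨Finset.mem_Icc.2 ⟨Fin.le_def.2 (by simp only; omega),
            Fin.le_def.2 (by simp only; omega)⟩, Finset.mem_Icc.2 ⟨Fin.le_def.2 (by omega), hyw⟩,
            ?_, ?_, ?_, ?_⟩
          · intro h
            have := congrArg Fin.val h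
            simp only at this
            omega
          · intro h
            obtain ⟨i, j, hij, h1, h2, h3⟩ := (hG _ _ (Fin.lt_def.2 (by simp only; omega))).1 h
            have := hD.lt hij
            simp only at h2
            have e : j = i + 1 := by omega
            subst e
            exact hshort i hij
          · rintro ⟨h, rfl⟩
            have := congrArg Fin.val h
            simp only at this
            omega
          · rintro ⟨-, rfl⟩
            omega
      exact key (w - u) w (by omega) le_rfl)
    hcard.symm)
  exact_mod_cast this

/-! ### Comparing induced pairs in `G_n` and in `G_{3r}`. -/

/-- The map that inserts `n - m` vertices at position `t`. -/
def gapMap {m n : ℕ} (hmn : m ≤ n) (t : ℕ) (v : Fin m) : Fin n :=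
  if (v : ℕ) < t then ⟨v, by omega⟩ else ⟨v + (n - m), by omega⟩

theorem gapMap_val {m n : ℕ} (hmn : m ≤ n) (t : ℕ) (v : Fin m) :
    (gapMap hmn t v : ℕ) = if (v : ℕ) < t then (v : ℕ) else v + (n - m) := by
  unfold gapMap
  split_ifs <;> rfl

theorem gapMap_adj_of_lt {m n : ℕ} {G : SimpleGraph (Fin m)} {G' : SimpleGraph (Fin n)}
    (hG : IsShiftGraph D r G) (hG' : IsShiftGraph D r G') (hD : EdgeData D r p q)
    (hm : 3 * r = m) (hmn : m ≤ n) {i₀ : ℕ} (hi₀ : D i₀ (i₀ + 1)) {a b : Fin m} (hab : a < b) :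
    G'.Adj (gapMap hmn (i₀ + r) a) (gapMap hmn (i₀ + r) b) ↔ G.Adj a b := by
  have hir := hD.lt_r hi₀
  have ha := gapMap_val hmn (i₀ + r) a
  have hb := gapMap_val hmn (i₀ + r) b
  have hab' := Fin.lt_def.1 hab
  have hlt : gapMap hmn (i₀ + r) a < gapMap hmn (i₀ + r) b := by
    rw [Fin.lt_def, ha, hb]
    split_ifs <;> omega
  rw [hG _ _ hab, hG' _ _ hlt, ha, hb]
  -- Here the edge `i₀, i₀ + 1` already joins both pairs. Otherwise one vertex is near an end, and
  -- each edge of `D` imposes equivalent conditions before and after the insertion.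
  by_cases hM : i₀ ≤ (a : ℕ) ∧ (b : ℕ) + r ≤ m + (i₀ + 1)
  · refine iff_of_true ⟨i₀, i₀ + 1, hi₀, ?_, ?_, ?_⟩ ⟨i₀, i₀ + 1, hi₀, hM.1, by omega, hM.2⟩
    all_goals split_ifs <;> omega
  · refine exists_congr fun i => exists_congr fun j => and_congr_right fun hij => ?_
    have := hD.lt hij
    have := hD.lt_r hij
    split_ifs <;> omega

theorem gapMap_adj {m n : ℕ} {G : SimpleGraph (Fin m)} {G' : SimpleGraph (Fin n)}
    (hG : IsShiftGraph D r G) (hG' : IsShiftGraph D r G') (hD : EdgeData D r p q)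
    (hm : 3 * r = m) (hmn : m ≤ n) {i₀ : ℕ} (hi₀ : D i₀ (i₀ + 1)) (a b : Fin m) :
    G'.Adj (gapMap hmn (i₀ + r) a) (gapMap hmn (i₀ + r) b) ↔ G.Adj a b := by
  rcases lt_trichotomy a b with h | rfl | h
  · exact gapMap_adj_of_lt hG hG' hD hm hmn hi₀ h
  · exact iff_of_false (fun h => h.ne rfl) fun h => h.ne rfl
  · rw [G'.adj_comm, G.adj_comm]
    exact gapMap_adj_of_lt hG hG' hD hm hmn hi₀ h

/-- An inserted vertex is adjacent to every other core vertex: to the near ones through the edge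
`i₀, i₀ + 1`, to the far ones by `ends_of_not_adj_of_long`. Each vertex of an induced pair has a
core non-neighbour, so no inserted vertex takes part in one. -/
theorem exists_gapMap_eq {m n : ℕ} {G' : SimpleGraph (Fin n)}
    (hG' : IsShiftGraph D r G') (hD : EdgeData D r p q)
    (hm : 3 * r = m) (hmn : m ≤ n) {i₀ : ℕ} (hi₀ : D i₀ (i₀ + 1)) {v x : Fin n}
    (hv : v ∈ core n r p q) (hx : x ∈ core n r p q) (hne : v ≠ x) (hvx : ¬ G'.Adj v x) :
    ∃ a : Fin m, gapMap hmn (i₀ + r) a = v := by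
  have hir := hD.lt_r hi₀
  have hvn := v.2
  by_cases h1 : (v : ℕ) < i₀ + r
  · refine ⟨⟨v, by omega⟩, Fin.ext ?_⟩
    rw [gapMap_val, if_pos h1]
  by_cases h2 : i₀ + r + (n - m) ≤ (v : ℕ)
  · refine ⟨⟨v - (n - m), by omega⟩, Fin.ext ?_⟩
    rw [gapMap_val, if_neg (by simp only; omega)]
    simp only
    omega
  exfalso
  rcases lt_or_gt_of_ne hne with hlt | hlt
  · have hlt' := Fin.lt_def.1 hlt
    by_cases hl : (v : ℕ) + r ≤ x
    · have := ends_of_not_adj_of_long hG' hD hv hx hvx hl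
      omega
    · exact hvx (hG'.adj hD hi₀ (by omega) (by omega) (by omega))
  · have hlt' := Fin.lt_def.1 hlt
    by_cases hl : (x : ℕ) + r ≤ v
    · have := ends_of_not_adj_of_long hG' hD hx hv (fun h => hvx h.symm) hl
      omega
    · exact hvx (hG'.adj hD hi₀ (by omega) (by omega) (by omega)).symm

theorem hasInducedPair_iff {m n : ℕ} {G : SimpleGraph (Fin m)} {G' : SimpleGraph (Fin n)}
    (hG : IsShiftGraph D r G) (hG' : IsShiftGraph D r G') (hD : EdgeData D r p q)
    (hm : 3 * r = m) (hmn : m ≤ n) {i₀ : ℕ} (hi₀ : D i₀ (i₀ + 1)) :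
    HasInducedPair G' ↔ HasInducedPair G := by
  have key := gapMap_adj hG hG' hD hm hmn hi₀
  constructor
  · rintro ⟨x, x', y, y', hx, hy, h1, h2, h3, h4⟩
    have c1 := mem_core_of_adj hG' hD hx
    have c2 := mem_core_of_adj hG' hD hx.symm
    have c3 := mem_core_of_adj hG' hD hy
    have c4 := mem_core_of_adj hG' hD hy.symm
    have n3 : x ≠ y := by rintro rfl; exact h3 hx.symm
    have n6 : x' ≠ y' := by rintro rfl; exact h2 hx
    obtain ⟨a, rfl⟩ := exists_gapMap_eq hG' hD hm hmn hi₀ c1 c3 n3 h1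
    obtain ⟨b, rfl⟩ := exists_gapMap_eq hG' hD hm hmn hi₀ c3 c1 n3.symm fun h => h1 h.symm
    obtain ⟨a', rfl⟩ := exists_gapMap_eq hG' hD hm hmn hi₀ c2 c4 n6 h4
    obtain ⟨b', rfl⟩ := exists_gapMap_eq hG' hD hm hmn hi₀ c4 c2 n6.symm fun h => h4 h.symm
    simp only [key] at *
    exact ⟨a, a', b, b', hx, hy, h1, h2, h3, h4⟩
  · rintro ⟨x, x', y, y', h⟩
    exact ⟨gapMap hmn (i₀ + r) x, gapMap hmn (i₀ + r) x', gapMap hmn (i₀ + r) y,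
      gapMap hmn (i₀ + r) y', by simpa only [key] using h⟩

/-- The regularity of the edge ideals of a family of shift graphs. -/
theorem reg_shiftGraph (hG : IsShiftGraph D r G) (hD : EdgeData D r p q) (hn : 4 * r ≤ n)
    {G₃ : SimpleGraph (Fin (3 * r))} (hG₃ : IsShiftGraph D r G₃) :
    (reg (edgeIdeal 𝕜 G) = 2 ∧ (D p q ∨ (∃ i, D i (i + 1)) ∧ ¬ HasInducedPair G₃)) ∨
    (reg (edgeIdeal 𝕜 G) = 3 ∧ ¬ (D p q ∨ (∃ i, D i (i + 1)) ∧ ¬ HasInducedPair G₃)) := by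
  obtain ⟨j, hj⟩ := hD.exists_p
  have h1 := hD.lt hj
  have h2 := hD.lt_r hj
  have hadj : G.Adj ⟨p, by omega⟩ ⟨j, by omega⟩ :=
    hG.adj hD hj le_rfl (by simp only; omega) (by simp only; omega)
  have hle2 : RegLE 𝕜 G 2 Set.univ → reg (edgeIdeal 𝕜 G) = 2 := fun h =>
    le_antisymm (by exact_mod_cast reg_le h) (two_le_reg hadj)
  have hle3 : 3 ≤ reg (edgeIdeal 𝕜 G) → reg (edgeIdeal 𝕜 G) = 3 := fun h =>
    le_antisymm (by exact_mod_cast reg_le (regLE_three 𝕜 hG hD hn)) h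
  by_cases hpq : D p q
  · exact Or.inl ⟨hle2 (regLE_two_of_rect 𝕜 hG hD hn hpq), Or.inl hpq⟩
  by_cases hs : ∃ i, D i (i + 1)
  · obtain ⟨i, hi⟩ := hs
    have hiff := hasInducedPair_iff hG₃ hG hD rfl (by omega) hi
    by_cases hp : HasInducedPair G₃
    · refine Or.inr ⟨hle3 (three_le_reg_of_inducedPair 𝕜 (hiff.2 hp)), ?_⟩
      rintro (h | h)
      · exact hpq h
      · exact h.2 hp
    · exact Or.inl ⟨hle2 (regLE_two_of_short 𝕜 hG hD hn hi fun h => hp (hiff.1 h)),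
        Or.inr ⟨⟨i, hi⟩, hp⟩⟩
  · refine Or.inr ⟨hle3 (three_le_reg_of_no_short 𝕜 hG hD hn hpq fun i hi => hs ⟨i, hi⟩), ?_⟩
    rintro (h | h)
    · exact hpq h
    · exact hs h.1

end Shift

/-! ### The bound on the `q`-invariant. -/

section QInvariant

variable {𝕜 : Type*} [Field 𝕜] {n : ℕ} {G : SimpleGraph (Fin n)}

theorem degree_single_add_single (u v : Fin n) :
    (Finsupp.single u 1 + Finsupp.single v 1 : Fin n →₀ ℕ).degree = 2 := by
  simp [map_add]

theorem mem_minGens_edgeIdeal {a : Fin n →₀ ℕ} : a ∈ minGens (edgeIdeal 𝕜 G) ↔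
    ∃ u v, G.Adj u v ∧ a = Finsupp.single u 1 + Finsupp.single v 1 := by
  have hmem : ∀ b : Fin n →₀ ℕ, monomial b (1 : 𝕜) ∈ edgeIdeal 𝕜 G ↔
      ∃ u v, G.Adj u v ∧ Finsupp.single u 1 + Finsupp.single v 1 ≤ b := by
    intro b
    rw [monomial_mem_edgeIdeal one_ne_zero]
    exact exists_congr fun u => exists_congr fun v => and_congr_right fun h =>
      (single_add_single_le h.ne).symm
  simp only [minGens, hmem, Set.mem_ofPred_eq]
  constructor
  · rintro ⟨⟨u, v, h, hle⟩, hmin⟩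
    exact ⟨u, v, h, le_antisymm (hmin ⟨u, v, h, le_rfl⟩ hle) hle⟩
  · rintro ⟨u, v, h, rfl⟩
    refine ⟨⟨u, v, h, le_rfl⟩, ?_⟩
    rintro b ⟨u', v', h', hle'⟩ hle
    have h2 : Finsupp.single u' 1 + Finsupp.single v' 1 =
        (Finsupp.single u 1 + Finsupp.single v 1 : Fin n →₀ ℕ) := by
      have hle'' := hle'.trans hle
      have hd := congrArg Finsupp.degree (tsub_add_cancel_of_le hle'')
      rw [map_add, degree_single_add_single, degree_single_add_single] at hd
      have h0 : ((Finsupp.single u 1 + Finsupp.single v 1) -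
          (Finsupp.single u' 1 + Finsupp.single v' 1) : Fin n →₀ ℕ).degree = 0 := by omega
      exact le_antisymm hle'' (tsub_eq_zero_iff_le.1 ((Finsupp.degree_eq_zero_iff _).1 h0))
    exact h2 ▸ hle'

theorem maxGenDegree_edgeIdeal_le : maxGenDegree (edgeIdeal 𝕜 G) ≤ 2 := by
  refine csSup_le' ?_
  rintro _ ⟨a, ha, rfl⟩
  obtain ⟨u, v, -, rfl⟩ := mem_minGens_edgeIdeal.1 ha
  exact (degree_single_add_single u v).le

theorem lt_maxSupp {u v : Fin n} (h : G.Adj u v) : (u : ℕ) < maxSupp (edgeIdeal 𝕜 G) := by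
  have hbdd : BddAbove (monoMaxSupp '' minGens (edgeIdeal 𝕜 G)) := by
    refine ⟨n, ?_⟩
    rintro _ ⟨a, -, rfl⟩
    exact Finset.sup_le fun i _ => i.2
  have h1 : monoMaxSupp (Finsupp.single u 1 + Finsupp.single v 1) ≤ maxSupp (edgeIdeal 𝕜 G) :=
    le_csSup hbdd ⟨_, mem_minGens_edgeIdeal.2 ⟨u, v, h, rfl⟩, rfl⟩
  have h2 : (u : ℕ) + 1 ≤ monoMaxSupp (Finsupp.single u 1 + Finsupp.single v 1 : Fin n →₀ ℕ) :=
    Finset.le_sup (f := fun i : Fin n => (i : ℕ) + 1) (by simp)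
  omega

theorem finite_homogeneousSubmodule (d : ℕ) :
    Module.Finite 𝕜 (homogeneousSubmodule (Fin n) 𝕜 d) :=
  Module.Finite.iff_fg.2 (homogeneousSubmodule_fg (Fin n) 𝕜 d)

theorem finrank_homogeneousSubmodule (d : ℕ) :
    Module.finrank 𝕜 (homogeneousSubmodule (Fin n) 𝕜 d) = n.multichoose d := by
  have h : homogeneousSubmodule (Fin n) 𝕜 d = restrictSupport 𝕜 {m | m.degree = d} :=
    homogeneousSubmodule_eq_finsupp_supported _ _ _
  have hs : {m : Fin n →₀ ℕ | m.degree = d} =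
      ((Finset.univ : Finset (Fin n)).finsuppAntidiag d : Set (Fin n →₀ ℕ)) := by
    ext m
    simp only [Finset.mem_coe, mem_finsuppAntidiag_univ, Set.mem_ofPred_eq]
  rw [h, Module.finrank_eq_nat_card_basis (basisRestrictSupport 𝕜 _), hs,
    Nat.card_coe_set_eq, Set.ncard_coe_finset, Finset.card_finsuppAntidiag_nat_eq_multichoose,
    Finset.card_univ, Fintype.card_fin]

theorem finite_subringPart (p d : ℕ) : Module.Finite 𝕜 (subringPart 𝕜 n p d) :=
  have := finite_homogeneousSubmodule (𝕜 := 𝕜) (n := n) d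
  Submodule.finiteDimensional_of_le inf_le_left

theorem finrank_subringPart_le (p d : ℕ) :
    Module.finrank 𝕜 (subringPart 𝕜 n p d) ≤ n.multichoose d := by
  have := finite_homogeneousSubmodule (𝕜 := 𝕜) (n := n) d
  rw [← finrank_homogeneousSubmodule (𝕜 := 𝕜)]
  exact Submodule.finrank_mono inf_le_left

/-- Only degrees 0, 1, 2 contribute, at most `1 + n + (n(n+1)/2 - 1)` in total; the last `-1` comes
from the monomial of the edge `uv`, which lies in the ideal and in the subring. -/
theorem qInvariant_edgeIdeal_le {u v : Fin n} (h : G.Adj u v) :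
    2 * qInvariant (edgeIdeal 𝕜 G) ≤ n ^ 2 + 3 * n := by
  set I := edgeIdeal 𝕜 G with hI
  set f : ℕ → ℕ := fun d => Module.finrank 𝕜
      (subringPart 𝕜 n (maxSupp I) d ⧸
        (I.restrictScalars 𝕜).submoduleOf (subringPart 𝕜 n (maxSupp I) d)) with hf
  have hle : ∀ d, f d ≤ n.multichoose d := by
    intro d
    have := finite_subringPart (𝕜 := 𝕜) (n := n) (maxSupp I) d
    exact (Submodule.finrank_quotient_le _).trans (finrank_subringPart_le _ _)
  have hlt : f 2 + 1 ≤ n.multichoose 2 := by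
    have := finite_subringPart (𝕜 := 𝕜) (n := n) (maxSupp I) 2
    refine le_trans ?_ (finrank_subringPart_le (𝕜 := 𝕜) (maxSupp I) 2)
    rw [← Submodule.finrank_quotient_add_finrank
      ((I.restrictScalars 𝕜).submoduleOf (subringPart 𝕜 n (maxSupp I) 2))]
    refine Nat.add_le_add_left (Nat.one_le_iff_ne_zero.2 fun h0 => ?_) _
    have hX : (X u * X v : MvPolynomial (Fin n) 𝕜) ∈ subringPart 𝕜 n (maxSupp I) 2 := by
      refine ⟨(isHomogeneous_X 𝕜 u).mul (isHomogeneous_X 𝕜 v), ?_⟩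
      exact (supported 𝕜 {i : Fin n | (i : ℕ) < maxSupp I}).mul_mem
        (X_mem_supported.2 (lt_maxSupp h)) (X_mem_supported.2 (lt_maxSupp h.symm))
    have hXI : (X u * X v : MvPolynomial (Fin n) 𝕜) ∈ I := Ideal.subset_span ⟨u, v, h, rfl⟩
    have hbot := Submodule.finrank_eq_zero.1 h0
    have : (⟨X u * X v, hX⟩ : subringPart 𝕜 n (maxSupp I) 2) ∈
        (I.restrictScalars 𝕜).submoduleOf (subringPart 𝕜 n (maxSupp I) 2) := hXI
    rw [hbot, Submodule.mem_bot] at this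
    have h0' := congrArg Subtype.val this
    exact mul_ne_zero (X_ne_zero u) (X_ne_zero v) h0'
  have hsum : qInvariant I ≤ f 0 + f 1 + f 2 := by
    have : qInvariant I = ∑ d ∈ Finset.range (maxGenDegree I + 1), f d := rfl
    rw [this]
    refine (Finset.sum_le_sum_of_subset (Finset.range_mono (b := 3) ?_)).trans ?_
    · exact Nat.succ_le_succ maxGenDegree_edgeIdeal_le
    · simp [Finset.sum_range_succ]
  have h0 := hle 0
  have h1 := hle 1
  rw [Nat.multichoose_zero_right] at h0
  rw [Nat.multichoose_one_right] at h1
  have h2 : 2 * n.multichoose 2 = n ^ 2 + n := by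
    rw [Nat.multichoose_eq, show n + 2 - 1 = n + 1 by omega, Nat.choose_two_right,
      Nat.add_sub_cancel, Nat.mul_div_cancel' (by
        rw [mul_comm]
        exact (Nat.even_mul_succ_self n).two_dvd)]
    ring
  omega

end QInvariant

/-! ### Orbits of edges and stabilization of the chain. -/

section Stability

/-- The graph obtained from `G` by applying all maps in `Inc m n`. -/
def orbitGraph {m : ℕ} (G : SimpleGraph (Fin m)) (n : ℕ) : SimpleGraph (Fin n) where
  Adj a b := ∃ π ∈ Inc m n, ∃ u v : Fin m, G.Adj u v ∧ (a : ℕ) = π u ∧ (b : ℕ) = π v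
  symm := ⟨fun _ _ ⟨π, hπ, u, v, h, ha, hb⟩ => ⟨π, hπ, v, u, h.symm, hb, ha⟩⟩
  loopless := ⟨fun _ ⟨_, hπ, _, _, h, ha, hb⟩ =>
    h.ne (Fin.ext (hπ.1.injective (ha.symm.trans hb)))⟩

/-- The edges of a graph on `Fin m`, as pairs of natural numbers `i < j`. -/
def edgePair {m : ℕ} (G : SimpleGraph (Fin m)) (i j : ℕ) : Prop :=
  i < j ∧ ∃ (hi : i < m) (hj : j < m), G.Adj ⟨i, hi⟩ ⟨j, hj⟩

theorem exists_inc {m n i j a b : ℕ} (hij : i < j) (hj : j < m) (h₁ : i ≤ a)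
    (h₂ : j + a ≤ b + i) (h₃ : b + m ≤ n + j) : ∃ π ∈ Inc m n, π i = a ∧ π j = b := by
  refine ⟨fun x => if x < i then x else if x < j then a + (x - i) else b + (x - j), ⟨?_, ?_⟩,
    ?_, ?_⟩
  · intro x y hxy
    simp only
    split_ifs <;> omega
  · intro x hx
    simp only
    split_ifs <;> omega
  · simp [hij]
  · simp [hij.not_gt]

/-- A strictly increasing map can shorten none of the three gaps before, between and after the ends
of an edge; conversely `exists_inc` realizes every lengthening. -/
theorem isShiftGraph_orbitGraph {m : ℕ} (G : SimpleGraph (Fin m)) (n : ℕ) :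
    IsShiftGraph (edgePair G) m (orbitGraph G n) := by
  intro a b hab
  constructor
  · rintro ⟨π, hπ, u, v, h, ha, hb⟩
    have hlt : π u < π v := by
      rw [← ha, ← hb]
      exact hab
    have huv : (u : ℕ) < v := hπ.1.lt_iff_lt.1 hlt
    refine ⟨u, v, ⟨huv, u.2, v.2, h⟩, ?_, ?_, ?_⟩
    · rw [ha]
      exact hπ.1.le_apply
    · have := hπ.1.add_le_nat (v - u) u
      rw [Nat.sub_add_cancel huv.le] at this
      omega
    · have hv := v.2
      have h1 := hπ.1.add_le_nat (m - 1 - v) v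
      rw [Nat.sub_add_cancel (by omega)] at h1
      have := hπ.2 (m - 1) (by omega)
      omega
  · rintro ⟨i, j, ⟨hij, hi, hj, h⟩, h1, h2, h3⟩
    obtain ⟨π, hπ, hi', hj'⟩ := exists_inc hij hj h1 h2 h3
    exact ⟨π, hπ, _, _, h, hi'.symm, hj'.symm⟩

variable {𝕜 : Type*} [Field 𝕜]

theorem incAct_X {m n : ℕ} {π : ℕ → ℕ} (hπ : π ∈ Inc m n) (u : Fin m) :
    incAct 𝕜 hπ (X u) = X ⟨π u, hπ.2 u u.2⟩ := rename_X _ _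

theorem X_mul_X_mem_edgeIdeal {n : ℕ} {G : SimpleGraph (Fin n)} {a b : Fin n} :
    (X a * X b : MvPolynomial (Fin n) 𝕜) ∈ edgeIdeal 𝕜 G ↔ G.Adj a b := by
  classical
  refine ⟨fun h => ?_, fun h => Ideal.subset_span ⟨a, b, h, rfl⟩⟩
  have hX : (X a * X b : MvPolynomial (Fin n) 𝕜) =
      monomial (Finsupp.single a 1 + Finsupp.single b 1) 1 := by simp [X, monomial_mul]
  rw [hX, monomial_mem_edgeIdeal one_ne_zero] at h
  obtain ⟨u, v, hadj, hu, hv⟩ := h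
  have key : ∀ x, (Finsupp.single a 1 + Finsupp.single b 1 : Fin n →₀ ℕ) x ≠ 0 →
      x = a ∨ x = b := by
    intro x hx
    by_contra hne
    rw [not_or] at hne
    simp [Ne.symm hne.1, Ne.symm hne.2] at hx
  rcases key u hu with rfl | rfl <;> rcases key v hv with rfl | rfl
  · exact (hadj.ne rfl).elim
  · exact hadj
  · exact hadj.symm
  · exact (hadj.ne rfl).elim

theorem edgeIdeal_injective {n : ℕ} {G G' : SimpleGraph (Fin n)}
    (h : edgeIdeal 𝕜 G = edgeIdeal 𝕜 G') : G = G' := by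
  ext a b
  rw [← X_mul_X_mem_edgeIdeal (𝕜 := 𝕜), h, X_mul_X_mem_edgeIdeal]

theorem orbitIdeal_edgeIdeal {m : ℕ} (G : SimpleGraph (Fin m)) (n : ℕ) :
    orbitIdeal (edgeIdeal 𝕜 G) n = edgeIdeal 𝕜 (orbitGraph G n) := by
  apply le_antisymm
  · refine Ideal.span_le.2 ?_
    rintro _ ⟨π, hπ, f, hf, rfl⟩
    have : edgeIdeal 𝕜 G ≤ (edgeIdeal 𝕜 (orbitGraph G n)).comap (incAct 𝕜 hπ) := by
      refine Ideal.span_le.2 ?_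
      rintro _ ⟨u, v, h, rfl⟩
      rw [SetLike.mem_coe, Ideal.mem_comap, map_mul, incAct_X, incAct_X, X_mul_X_mem_edgeIdeal]
      exact ⟨π, hπ, u, v, h, rfl, rfl⟩
    exact this hf
  · refine Ideal.span_le.2 ?_
    rintro _ ⟨a, b, ⟨π, hπ, u, v, h, ha, hb⟩, rfl⟩
    refine Ideal.subset_span ⟨π, hπ, X u * X v, X_mul_X_mem_edgeIdeal.2 h, ?_⟩
    rw [map_mul, incAct_X, incAct_X]
    congr <;> exact Fin.ext (by assumption)

theorem edgePair_of_invariant {I : (n : ℕ) → Ideal (MvPolynomial (Fin n) 𝕜)}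
    {G : (n : ℕ) → SimpleGraph (Fin n)} (hinv : IsInvariantChain I)
    (hedge : ∀ n, 1 ≤ n → I n = edgeIdeal 𝕜 (G n)) {m n i j a b : ℕ} (hmn : m ≤ n)
    (hij : edgePair (G m) i j) (h₁ : i ≤ a) (h₂ : j + a ≤ b + i) (h₃ : b + m ≤ n + j) :
    edgePair (G n) a b := by
  obtain ⟨hlt, hi, hj, hadj⟩ := hij
  rcases hmn.eq_or_lt with rfl | hmn
  · obtain rfl : a = i := by omega
    obtain rfl : b = j := by omega
    exact ⟨hlt, hi, hj, hadj⟩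
  · obtain ⟨π, hπ, rfl, rfl⟩ := exists_inc hlt hj h₁ h₂ h₃
    refine ⟨hπ.1 hlt, hπ.2 i hi, hπ.2 j hj, ?_⟩
    have h := hinv m n (by omega) hmn π hπ (X ⟨i, hi⟩ * X ⟨j, hj⟩) (by
      rw [hedge m (by omega)]
      exact X_mul_X_mem_edgeIdeal.2 hadj)
    rwa [map_mul, incAct_X, incAct_X, hedge n (by omega), X_mul_X_mem_edgeIdeal] at h

/-- Interpolation in `ℕ³` at a prescribed sum, used to route an edge of `G_n` through one fixed
graph. -/
theorem exists_between_triple {s₁ s₂ s₃ t₁ t₂ t₃ K : ℕ} (h₁ : s₁ ≤ t₁) (h₂ : s₂ ≤ t₂)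
    (h₃ : s₃ ≤ t₃) (hs : s₁ + s₂ + s₃ ≤ K) (ht : K ≤ t₁ + t₂ + t₃) :
    ∃ w₁ w₂ w₃, s₁ ≤ w₁ ∧ w₁ ≤ t₁ ∧ s₂ ≤ w₂ ∧ w₂ ≤ t₂ ∧ s₃ ≤ w₃ ∧ w₃ ≤ t₃ ∧
      w₁ + w₂ + w₃ = K := by
  by_cases hA : K ≤ t₁ + s₂ + s₃
  · exact ⟨K - s₂ - s₃, s₂, s₃, by omega, by omega, by omega, by omega, by omega, by omega,
      by omega⟩
  by_cases hB : K ≤ t₁ + t₂ + s₃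
  · exact ⟨t₁, K - t₁ - s₃, s₃, by omega, by omega, by omega, by omega, by omega, by omega,
      by omega⟩
  · exact ⟨t₁, t₂, K - t₁ - t₂, by omega, by omega, by omega, by omega, by omega, by omega,
      by omega⟩

/-- Every invariant chain of edge ideals stabilizes. -/
theorem exists_stable {I : (n : ℕ) → Ideal (MvPolynomial (Fin n) 𝕜)}
    {G : (n : ℕ) → SimpleGraph (Fin n)} (hinv : IsInvariantChain I)
    (hedge : ∀ n, 1 ≤ n → I n = edgeIdeal 𝕜 (G n)) :
    {r | 1 ≤ r ∧ ∀ n, r ≤ n → I n = orbitIdeal (I r) n}.Nonempty := by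
  classical
  -- An edge `a < b` of `G_n` is encoded by its gaps `(a, b - a - 1, n - 1 - b)`, of sum `n - 2`.
  -- Invariance makes `U` an upper set, so Dickson's lemma leaves finitely many minimal triples.
  set U : ℕ × ℕ × ℕ → Prop := fun t =>
    edgePair (G (t.1 + t.2.1 + t.2.2 + 2)) t.1 (t.1 + t.2.1 + 1) with hU
  have hfin : {t | Minimal U t}.Finite := by
    have := setOfPred_minimal_antichain U
    exact this.finite_of_partiallyWellOrderedOn (Set.isPWO_of_wellQuasiOrderedLE _)
  set K := hfin.toFinset.sup (fun t => t.1 + t.2.1 + t.2.2) with hK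
  -- Every triple of `U` with sum at least `K` dominates a minimal one of sum at most `K`, hence one
  -- of sum exactly `K`, which is an edge of `G_{K+2}`.
  refine ⟨K + 2, by simp, fun n hn => ?_⟩
  rw [hedge n (by omega), hedge (K + 2) (by omega), orbitIdeal_edgeIdeal]
  congr 1
  have key : ∀ a b : Fin n, a < b → ((G n).Adj a b ↔ (orbitGraph (G (K + 2)) n).Adj a b) := by
    intro a b hab
    have hab' := Fin.lt_def.1 hab
    have hb := b.2
    rw [isShiftGraph_orbitGraph _ _ a b hab]
    constructor
    · intro h
      have hUt : U ((a : ℕ), (b : ℕ) - a - 1, n - 1 - b) := by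
        simp only [hU]
        rw [show (a : ℕ) + (b - a - 1) + (n - 1 - b) + 2 = n by omega,
          show (a : ℕ) + (b - a - 1) + 1 = b by omega]
        exact ⟨hab', a.2, b.2, h⟩
      obtain ⟨s, hs, hmin⟩ := exists_minimal_le_of_wellFoundedLT U _ hUt
      have hsK : s.1 + s.2.1 + s.2.2 ≤ K := Finset.le_sup
        (f := fun t : ℕ × ℕ × ℕ => t.1 + t.2.1 + t.2.2) (hfin.mem_toFinset.2 hmin)
      obtain ⟨w₁, w₂, w₃, h1, h2, h3, h4, h5, h6, h7⟩ := exists_between_triple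
        (K := K) hs.1 hs.2.1 hs.2.2 hsK (by simp only; omega)
      simp only at h2 h4 h6
      refine ⟨w₁, w₁ + w₂ + 1, edgePair_of_invariant hinv hedge ?_ hmin.1 h1 ?_ ?_, h2, ?_, ?_⟩
        <;> omega
    · rintro ⟨i, j, hij, h1, h2, h3⟩
      obtain ⟨_, _, _, h⟩ := edgePair_of_invariant hinv hedge hn hij h1 h2 h3
      exact h
  ext a b
  rcases lt_trichotomy a b with h | rfl | h
  · exact key a b h
  · exact iff_of_false (fun h => h.ne rfl) fun h => h.ne rfl
  · rw [(G n).adj_comm, (orbitGraph (G (K + 2)) n).adj_comm]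
    exact key b a h

theorem exists_edgeData {m : ℕ} {G : SimpleGraph (Fin m)} {i j : ℕ} (h : edgePair G i j) :
    ∃ p q, EdgeData (edgePair G) m p q := by
  classical
  have hex : ∃ p, ∃ j, edgePair G p j := ⟨i, j, h⟩
  refine ⟨Nat.find hex, Nat.findGreatest (fun q => ∃ i, edgePair G i q) m,
    fun h => h.1, fun h => h.2.2.1, fun h => Nat.find_min' hex ⟨_, h⟩, Nat.find_spec hex,
    fun h => Nat.le_findGreatest h.2.2.1.le ⟨_, h⟩,
    Nat.findGreatest_spec (P := fun q => ∃ i, edgePair G i q) h.2.2.1.le ⟨_, h⟩⟩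

end Stability

/-! ### Induced matching number 1 means having no induced pair. -/

section IndMatch

variable {n : ℕ} {G : SimpleGraph (Fin n)}

theorem HasInducedPair.of_embedding {g : ℕ} (hg : 2 ≤ g) (f : disjointEdges g ↪g G) :
    HasInducedPair G := by
  have key : ∀ a b, G.Adj (f a) (f b) ↔ (a.1 = b.1 ∧ a.2 ≠ b.2) := fun a b => f.map_rel_iff
  refine ⟨f (⟨0, by omega⟩, false), f (⟨0, by omega⟩, true), f (⟨1, by omega⟩, false),
    f (⟨1, by omega⟩, true), ?_⟩
  simp [key]

theorem HasInducedPair.exists_embedding (h : HasInducedPair G) :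
    Nonempty (disjointEdges 2 ↪g G) := by
  obtain ⟨x, x', y, y', hx, hy, h1, h2, h3, h4⟩ := h
  have n1 := hx.ne
  have n2 := hy.ne
  have n3 : x ≠ y := by rintro rfl; exact h3 hx.symm
  have n4 : x ≠ y' := by rintro rfl; exact h4 hx.symm
  have n5 : x' ≠ y := by rintro rfl; exact h1 hx
  have n6 : x' ≠ y' := by rintro rfl; exact h2 hx
  have hx' := hx.symm
  have hy' := hy.symm
  have h1' : ¬ G.Adj y x := fun h => h1 h.symm
  have h2' : ¬ G.Adj y' x := fun h => h2 h.symm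
  have h3' : ¬ G.Adj y x' := fun h => h3 h.symm
  have h4' : ¬ G.Adj y' x' := fun h => h4 h.symm
  set f : Fin 2 × Bool → Fin n :=
    fun a => if a.1 = 0 then (if a.2 then x' else x) else (if a.2 then y' else y) with hf
  refine ⟨⟨⟨f, ?_⟩, ?_⟩⟩
  · rintro ⟨a, b⟩ ⟨a', b'⟩ he
    fin_cases a <;> fin_cases a' <;> cases b <;> cases b' <;> simp_all
  · rintro ⟨a, b⟩ ⟨a', b'⟩
    change G.Adj (f (a, b)) (f (a', b')) ↔ _
    fin_cases a <;> fin_cases a' <;> cases b <;> cases b' <;> simp_all [disjointEdges]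

theorem exists_embedding_of_adj {u v : Fin n} (h : G.Adj u v) :
    Nonempty (disjointEdges 1 ↪g G) := by
  have hne := h.ne
  have h' := h.symm
  set f : Fin 1 × Bool → Fin n := fun a => if a.2 then u else v with hf
  refine ⟨⟨⟨f, ?_⟩, ?_⟩⟩
  · rintro ⟨a, b⟩ ⟨a', b'⟩ he
    cases b <;> cases b' <;> simp_all [Subsingleton.elim a a']
  · rintro ⟨a, b⟩ ⟨a', b'⟩
    change G.Adj (f (a, b)) (f (a', b')) ↔ _
    cases b <;> cases b' <;> simp_all [disjointEdges, Subsingleton.elim a a']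

theorem indMatch_eq_one_iff {u v : Fin n} (h : G.Adj u v) :
    indMatch G = 1 ↔ ¬ HasInducedPair G := by
  -- Boundedness matters: the supremum of an unbounded set of naturals is 0.
  have hbdd : BddAbove {g | Nonempty (disjointEdges g ↪g G)} := by
    refine ⟨n, ?_⟩
    rintro g ⟨f⟩
    have := Fintype.card_le_of_injective f f.injective
    simp only [Fintype.card_prod, Fintype.card_fin, Fintype.card_bool] at this
    omega
  constructor
  · intro h1 hp
    have : 2 ≤ indMatch G := le_csSup hbdd hp.exists_embedding
    omega
  · intro hp
    refine le_antisymm (csSup_le' ?_) (le_csSup hbdd (exists_embedding_of_adj h))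
    rintro g ⟨f⟩
    by_contra hg
    exact hp (HasInducedPair.of_embedding (by omega) f)

end IndMatch

/-! ### The lexicographic edge list and the conditions on `G_r`. -/

section EdgeList

variable {r s : ℕ} {G : SimpleGraph (Fin r)} {i j : Fin s → Fin r}

theorem IsEdgeList.edgePair_iff (h : IsEdgeList G i j) {a b : ℕ} :
    edgePair G a b ↔ ∃ t, (i t : ℕ) = a ∧ (j t : ℕ) = b := by
  constructor
  · rintro ⟨hab, ha, hb, hadj⟩
    rw [← SimpleGraph.mem_edgeSet, h.edgeSet_eq] at hadj
    obtain ⟨t, ht⟩ := hadj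
    rcases Sym2.eq_iff.1 ht with ⟨h1, h2⟩ | ⟨h1, h2⟩
    · exact ⟨t, by rw [← h1], by rw [← h2]⟩
    · have := Fin.lt_def.1 (h.lt t)
      rw [← h1, ← h2] at this
      simp only at this
      omega
  · rintro ⟨t, rfl, rfl⟩
    refine ⟨h.lt t, (i t).2, (j t).2, ?_⟩
    rw [← SimpleGraph.mem_edgeSet, h.edgeSet_eq]
    exact ⟨t, rfl⟩

theorem IsEdgeList.le_of_le (h : IsEdgeList G i j) {t t' : Fin s} (htt' : t ≤ t')
    (he : i t = i t') : j t ≤ j t' := by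
  have key : ∀ d (t' : Fin s), (t' : ℕ) = t + d → i t = i t' → j t ≤ j t' := by
    intro d
    induction d with
    | zero =>
      intro t' ht' _
      have : t' = t := Fin.ext (by omega)
      rw [this]
    | succ d ih =>
      intro t' ht' he'
      have hs := t'.2
      have hlt : (t : ℕ) + d < s := by omega
      have e1 : i t = i ⟨t + d, hlt⟩ := by
        apply le_antisymm (h.mono (Fin.le_def.2 (by simp only; omega)))
        rw [he']
        exact h.mono (Fin.le_def.2 (by simp only; omega))
      exact (ih ⟨t + d, hlt⟩ rfl e1).trans (h.lex ⟨t + d, hlt⟩ t' ht' (e1 ▸ he')).le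
  have := Fin.le_def.1 htt'
  exact key (t' - t) t' (by omega) he

/-- In lexicographic order the last edge with least left end `p` has the largest right end among
these edges, so that end is the overall maximum `q` iff `pq` is an edge. -/
theorem IsEdgeList.rect_iff (h : IsEdgeList G i j) {p q : ℕ} (hD : EdgeData (edgePair G) r p q)
    (hs : 0 < s) {t : Fin s} (ht : IsGreatest {t : Fin s | i t = i ⟨0, hs⟩} t) :
    IsGreatest (Set.range j) (j t) ↔ edgePair G p q := by
  have hp : (i ⟨0, hs⟩ : ℕ) = p := by
    apply le_antisymm
    · obtain ⟨b, hb⟩ := hD.exists_p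
      obtain ⟨t', rfl, -⟩ := h.edgePair_iff.1 hb
      exact h.mono (Fin.le_def.2 (Nat.zero_le _))
    · exact hD.p_le (h.edgePair_iff.2 ⟨_, rfl, rfl⟩)
  have hit : (i t : ℕ) = p := by rw [← hp, ht.1]
  constructor
  · rintro ⟨-, hmax⟩
    refine h.edgePair_iff.2 ⟨t, hit, le_antisymm (hD.le_q (h.edgePair_iff.2 ⟨t, rfl, rfl⟩)) ?_⟩
    obtain ⟨a, ha⟩ := hD.exists_q
    obtain ⟨t', -, rfl⟩ := h.edgePair_iff.1 ha
    exact hmax ⟨t', rfl⟩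
  · intro hpq
    obtain ⟨t', h1, h2⟩ := h.edgePair_iff.1 hpq
    refine ⟨⟨t, rfl⟩, ?_⟩
    rintro _ ⟨t'', rfl⟩
    have e : i t' = i ⟨0, hs⟩ := Fin.ext (h1.trans hp.symm)
    have hle := h.le_of_le (ht.2 e) (e.trans ht.1.symm)
    refine le_trans ?_ hle
    rw [Fin.le_def, h2]
    exact hD.le_q (h.edgePair_iff.2 ⟨t'', rfl, rfl⟩)

theorem IsEdgeList.short_iff (h : IsEdgeList G i j) :
    IsLeast (Set.range fun t => (j t : ℕ) - (i t : ℕ)) 1 ↔ ∃ a, edgePair G a (a + 1) := by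
  constructor
  · rintro ⟨⟨t, ht⟩, -⟩
    have := Fin.lt_def.1 (h.lt t)
    simp only at ht
    exact ⟨i t, h.edgePair_iff.2 ⟨t, rfl, by omega⟩⟩
  · rintro ⟨a, ha⟩
    obtain ⟨t, h1, h2⟩ := h.edgePair_iff.1 ha
    refine ⟨⟨t, ?_⟩, ?_⟩
    · simp only
      omega
    · rintro _ ⟨t', rfl⟩
      have := Fin.lt_def.1 (h.lt t')
      simp only
      omega

end EdgeList

end IncChain

/-! ### Assembly of the main theorem. -/

theorem theorem7p1 {𝕜 : Type*} [Field 𝕜]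
    (I : (n : ℕ) → Ideal (MvPolynomial (Fin n) 𝕜))
    (G : (n : ℕ) → SimpleGraph (Fin n))
    (hinv : IncChain.IsInvariantChain I)
    (hedge : ∀ n, 1 ≤ n → I n = IncChain.edgeIdeal 𝕜 (G n))
    (hne : ∀ᶠ n in atTop, I n ≠ ⊥)
    (r : ℕ) (hr : r = IncChain.stabilityIndex I)
    (N : ℕ)
    (hN : N = max (5 * r) (max (2 * r * (r - 2)) (4 * (r + IncChain.qInvariant (I r))))) :
    (∀ n, N ≤ n → IncChain.reg (I n) = IncChain.reg (I (n + 1))) ∧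
    N ≤ 2 * (r ^ 2 + 5 * r) ∧
    (∃ L : WithBot ℕ∞, (L = 2 ∨ L = 3) ∧ ∀ᶠ n in atTop, IncChain.reg (I n) = L) ∧
    ∀ (s : ℕ) (hs : 0 < s) (i j : Fin s → Fin r) (q : Fin s),
      IncChain.IsEdgeList (G r) i j →
      IsGreatest {t : Fin s | i t = i ⟨0, hs⟩} q →
      List.TFAE
        [∀ᶠ n in atTop, IncChain.reg (I n) = 2,
         IncChain.reg (I N) = 2,
         IsGreatest (Set.range j) (j q) ∨
           (IsLeast (Set.range fun t => (j t : ℕ) - (i t : ℕ)) 1 ∧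
             IncChain.indMatch (G (3 * r)) = 1)] := by
  open IncChain in
  obtain ⟨hr1, hstable⟩ : 1 ≤ r ∧ ∀ n, r ≤ n → I n = orbitIdeal (I r) n := by
    rw [hr]
    -- Nonemptiness is essential: the infimum of the empty set would be the meaningless value 0.
    exact Nat.sInf_mem (exists_stable hinv hedge)
  have hG : ∀ n, r ≤ n → IsShiftGraph (edgePair (G r)) r (G n) := by
    intro n hn
    have h := hstable n hn
    rw [hedge n (by omega), hedge r hr1, orbitIdeal_edgeIdeal] at h
    rw [edgeIdeal_injective h]
    exact isShiftGraph_orbitGraph _ _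
  -- If `G_r` had no edges, every later ideal would be zero.
  obtain ⟨a, b, hab⟩ : ∃ a b, edgePair (G r) a b := by
    by_contra hcon
    obtain ⟨n, hn, hrn⟩ := (hne.and (eventually_ge_atTop r)).exists
    apply hn
    rw [hedge n (by omega), eq_bot_iff]
    refine Ideal.span_le.2 ?_
    rintro _ ⟨u, v, h, rfl⟩
    exfalso
    rcases lt_or_gt_of_ne h.ne with hlt | hlt
    · obtain ⟨i, j, hij, -⟩ := (hG n hrn u v hlt).1 h
      exact hcon ⟨i, j, hij⟩
    · obtain ⟨i, j, hij, -⟩ := (hG n hrn v u hlt).1 h.symm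
      exact hcon ⟨i, j, hij⟩
  obtain ⟨p, m, hD⟩ := exists_edgeData hab
  set P : Prop := edgePair (G r) p m ∨
    (∃ i, edgePair (G r) i (i + 1)) ∧ ¬ HasInducedPair (G (3 * r)) with hP
  have hNr : 5 * r ≤ N := hN ▸ le_max_left _ _
  have hreg : ∀ n, N ≤ n → (reg (I n) = 2 ∧ P) ∨ (reg (I n) = 3 ∧ ¬ P) := by
    intro n hn
    rw [hedge n (by omega)]
    exact reg_shiftGraph 𝕜 (hG n (by omega)) hD (by omega) (hG (3 * r) (by omega))
  have h23 : (2 : WithBot ℕ∞) ≠ 3 := by decide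
  have hreg2 : ∀ n, N ≤ n → (reg (I n) = 2 ↔ P) := by
    intro n hn
    rcases hreg n hn with ⟨h, h'⟩ | ⟨h, h'⟩
    · exact iff_of_true h h'
    · exact iff_of_false (fun h2 => h23 (h2.symm.trans h)) h'
  refine ⟨fun n hn => ?_, ?_, ?_, ?_⟩
  · rcases hreg n hn with ⟨h, h'⟩ | ⟨h, h'⟩ <;>
      rcases hreg (n + 1) (by omega) with ⟨k, k'⟩ | ⟨k, k'⟩
    · rw [h, k]
    · exact (k' h').elim
    · exact (h' k').elim
    · rw [h, k]
  -- The third term of `N` is the one meeting the bound: `4r + 2(r² + 3r) = 2(r² + 5r)`.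
  · have hq : 2 * qInvariant (I r) ≤ r ^ 2 + 3 * r := by
      obtain ⟨-, ha, hb, hadj⟩ := hab
      rw [hedge r hr1]
      exact qInvariant_edgeIdeal_le hadj
    rw [hN]
    refine max_le ?_ (max_le ?_ ?_)
    · nlinarith
    · have : 2 * r * (r - 2) ≤ 2 * r * r := Nat.mul_le_mul_left _ (Nat.sub_le _ _)
      nlinarith
    · linarith
  · by_cases hp : P
    · exact ⟨2, Or.inl rfl, (eventually_ge_atTop N).mono fun n hn => (hreg2 n hn).2 hp⟩
    · exact ⟨3, Or.inr rfl, (eventually_ge_atTop N).mono fun n hn =>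
        ((hreg n hn).resolve_left fun h => hp h.2).1⟩
  · intro s hs i j q hlist hq
    have h3 : (IsGreatest (Set.range j) (j q) ∨
        (IsLeast (Set.range fun t => (j t : ℕ) - (i t : ℕ)) 1 ∧
          indMatch (G (3 * r)) = 1)) ↔ P := by
      obtain ⟨h1, h2, h3, -⟩ := id hab
      -- An edge of `G_r`, kept in place, is an edge of `G_{3r}`; thus the induced matching number
      -- there is at least 1.
      have hadj := (hG (3 * r) (by omega)).adj hD hab
        (a := ⟨a, by omega⟩) (b := ⟨b, by omega⟩) le_rfl (by simp only; omega)
        (by simp only; omega)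
      rw [hlist.rect_iff hD hs hq, hlist.short_iff, indMatch_eq_one_iff hadj]
    have h1 : (∀ᶠ n in atTop, reg (I n) = 2) ↔ P := by
      constructor
      · intro h
        obtain ⟨n, hn, hNn⟩ := (h.and (eventually_ge_atTop N)).exists
        exact (hreg2 n hNn).1 hn
      · exact fun hp => (eventually_ge_atTop N).mono fun n hn => (hreg2 n hn).2 hp
    tfae_have 1 ↔ 2 := h1.trans (hreg2 N le_rfl).symm
    tfae_have 1 ↔ 3 := h1.trans h3.symm
    tfae_finish
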